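/- Let $q$ be a prime power, let $\mathcal C\subseteq \mathrm{GF}(q)^{m\times n}$ be a rank metric code (with at least two codewords) whose minimum rank distance is $d$, where $d_R(X,Y)=\mathrm{rk}(X-Y)$, and let $t=\lfloor (d-1)/2\rfloor$. Suppose that a codeword $C\in\mathcal C$ is sent over an equal row space channel (errors are additive, and errors with the same row space are equiprobable), and that the error has row space $U$, a subspace of $\mathrm{GF}(q)^n$ of dimension $u$ (an event of nonzero probability given that $C$ is sent). A bounded distance decoder of radius $t$ outputs a codeword at rank distance at most $t$ from the received matrix if there is one, and declares a failure otherwise. Let $\Pr(C,U,t)$ be the decoder error probability, that is, the conditional probability that the decoder outputs a codeword other than $C$. Notation: $\alpha(k,j)=\prod_{i=0}^{j-1}(q^k-q^i)$ (so $\alpha(k,0)=1$); ${n\brack w}=\alpha(n,w)/\alpha(w,w)$; $K_q=\prod_{j\ge 1}(1-q^{-j})$; $E_w(q,n)$ is the set of the $w$-dimensional subspaces of $\mathrm{GF}(q)^n$; $A_W(C)$ is the number of $D\in\mathcal C$ such that $D-C$ has row space $W$; $g_R(U,s,W)$ is the number of $m\times n$ matrices with row space $U$ at rank distance $s$ from a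 given matrix with row space $W$ ($0$ if there is no such matrix); $N_R(u)$ is the number of $m\times n$ matrices of rank $u$; $J_R(u,s,w)$ is the number of matrices at rank distances $u$ and $s$, respectively, from two given matrices at rank distance $w$ from each other ($0$ if there are no such two matrices). If $u<d-t$, then $\Pr(C,U,t)=0$. If $u\ge d-t$, then $$\Pr(C,U,t)=\frac1{\alpha(m,u)}\sum_{w=d}^n\sum_{W\in E_w(q,n)}A_W(C)\sum_{s=0}^t g_R(U,s,W)\le\frac1{N_R(u)}\sum_{w=d}^n{n\brack w}\alpha(m,w-d+1)\sum_{s=0}^tJ_R(u,s,w),$$ and the right-hand side is strictly less than $K_q^{-2}q^{-t(m-n+t)}$ when $d=2t+1$, and strictly less than $K_q^{-2}q^{-t(m-n+t)-m}$ when $d=2t+2$. Furthermore, if $n\le m$ and $\mathcal C$ is a linear maximum rank distance (MRD) code, that is, a linear code of the maximum cardinality $\min\{q^{m(n-d+1)},q^{n(m-d+1)}\}$, then $$\Pr(C,U,t)=\frac1{N_R(u)}\sum_{w=d}^nM(d,w)\sum_{s=0}^tJ_R(u,s,w),$$ where $M(d,w)$ is the number of codewords at rank distance $w$ from a given codeword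 in an MRD code in $\mathrm{GF}(q)^{m\times n}$ with minimum rank distance $d$. -/

import Mathlib

noncomputable section

namespace RankMetric

/-! ### Numerical functions -/

/-- `α(k, u) = ∏_{i < u} (q ^ k - q ^ i)`, with the empty product `α(k, 0) = 1`. -/
def alpha (q k u : ℕ) : ℝ := ∏ i ∈ Finset.range u, ((q : ℝ) ^ k - (q : ℝ) ^ i)

/-- The Gaussian binomial `α(n, r) / α(r, r)`. -/
def gaussBinom (q n r : ℕ) : ℝ := alpha q n r / alpha q r r

/-- `K_q = ∏_{j ≥ 1} (1 - q ^ (-j))`. -/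
def Kq (q : ℕ) : ℝ := ∏' j : ℕ, (1 - ((q : ℝ) ^ (j + 1))⁻¹)

/-- The infinite product defining `K_q` converges. -/
theorem multipliable_Kq (q : ℕ) (hq : 2 ≤ q) :
    Multipliable fun j : ℕ => (1 - ((q : ℝ) ^ (j + 1))⁻¹) := by
  have hq' : (1 : ℝ) < q := by exact_mod_cast (by omega : 1 < q)
  have hs : Summable fun j : ℕ => -((q : ℝ) ^ (j + 1))⁻¹ := by
    have h := summable_geometric_of_lt_one (r := ((q : ℝ))⁻¹) (by positivity)
      (inv_lt_one_of_one_lt₀ hq')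
    have h2 := ((summable_nat_add_iff 1).2 h).neg
    simpa only [inv_pow] using h2
  have := Real.multipliable_one_add_of_summable hs
  simpa only [sub_eq_add_neg] using this

variable {F : Type*} [Field F] {m n : ℕ}

/-! ### The rank metric -/

/-- The row space of a matrix. -/
def rowSpace (X : Matrix (Fin m) (Fin n) F) : Submodule F (Fin n → F) :=
  Submodule.span F (Set.range X.row)

/-- The rank distance `rk (X - Y)`. -/
def rankDist (X Y : Matrix (Fin m) (Fin n) F) : ℕ := (X - Y).rank

/-- The set of the matrices at rank distance `u` from `X`. -/
def sphere (X : Matrix (Fin m) (Fin n) F) (u : ℕ) : Set (Matrix (Fin m) (Fin n) F) :=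
  {Z | rankDist Z X = u}

/-- `E_w(q, n)`: the subspaces of dimension `w` of `F ^ n`. -/
def grassmannian (F : Type*) [Field F] [Finite F] (n w : ℕ) :
    Finset (Submodule F (Fin n → F)) :=
  (Set.toFinite {W : Submodule F (Fin n → F) | Module.finrank F W = w}).toFinset

/-- `N_R(u)`: the number of `m × n` matrices at rank distance `u` from a given matrix. The
zero matrix is taken as this matrix; see `ncard_sphere`. -/
def sphereCard (F : Type*) [Field F] (m n u : ℕ) : ℕ :=
  (sphere (0 : Matrix (Fin m) (Fin n) F) u).ncard

open Classical in
/-- `J_R(u, s, w)`: the number of matrices in the intersection of two spheres of radii `u` and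
`s` whose centers are at rank distance `w`. It does not depend on the centers, see
`ncard_sphere_inter`. It is `0` if no two `m × n` matrices are at rank distance `w`. -/
def interNum (F : Type*) [Field F] (m n u s w : ℕ) : ℕ :=
  if h : ∃ P : Matrix (Fin m) (Fin n) F × Matrix (Fin m) (Fin n) F, rankDist P.1 P.2 = w then
    (sphere h.choose.1 u ∩ sphere h.choose.2 s).ncard
  else 0

open Classical in
/-- `g_R(U, s, W)`: the number of `m × n` matrices with row space `U` and at rank distance `s`
from a matrix with row space `W`. It does not depend on the latter, see `ncard_rowSpace_sphere`.
It is `0` if no `m × n` matrix has row space `W`. -/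
def rowNum (m : ℕ) (U : Submodule F (Fin n → F)) (s : ℕ) (W : Submodule F (Fin n → F)) : ℕ :=
  if h : ∃ R : Matrix (Fin m) (Fin n) F, rowSpace R = W then
    {X : Matrix (Fin m) (Fin n) F | rowSpace X = U ∧ rankDist X h.choose = s}.ncard
  else 0

/-! ### Codes -/

/-- The code `𝒞` has two distinct codewords, and the least rank distance between distinct
codewords is `d`. -/
def HasMinDist (𝒞 : Set (Matrix (Fin m) (Fin n) F)) (d : ℕ) : Prop :=
  IsLeast {k | ∃ X ∈ 𝒞, ∃ Y ∈ 𝒞, X ≠ Y ∧ rankDist X Y = k} d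

/-- `𝒞` is a maximum rank distance code with minimum distance `d`: its cardinality is the
maximum one, `min {q ^ (m (n - d + 1)), q ^ (n (m - d + 1))}`. -/
def IsMRD (𝒞 : Set (Matrix (Fin m) (Fin n) F)) (d : ℕ) : Prop :=
  HasMinDist 𝒞 d ∧
    𝒞.ncard = min (Nat.card F ^ (m * (n - d + 1))) (Nat.card F ^ (n * (m - d + 1)))

/-- `𝒞` is linear: a linear subspace of the space of matrices over `F`. -/
def IsLinearCode (𝒞 : Set (Matrix (Fin m) (Fin n) F)) : Prop :=
  ∃ L : Submodule F (Matrix (Fin m) (Fin n) F), (L : Set (Matrix (Fin m) (Fin n) F)) = 𝒞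

/-- `A_W(C)`: the number of codewords `D` such that `D - C` has row space `W`. -/
def rowDistribution (𝒞 : Set (Matrix (Fin m) (Fin n) F)) (C : Matrix (Fin m) (Fin n) F)
    (W : Submodule F (Fin n → F)) : ℕ :=
  {D ∈ 𝒞 | rowSpace (D - C) = W}.ncard

open Classical in
/-- `M(d, w)`: the number of codewords at rank distance `w` from a given codeword, in a maximum
rank distance code with minimum distance `d` in the space of `m × n` matrices, `n ≤ m`. The code
and the codeword are arbitrary. It is `0` if there is no such code. -/
def mrdNum (F : Type*) [Field F] (m n d w : ℕ) : ℕ :=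
  if h : ∃ P : Set (Matrix (Fin m) (Fin n) F) × Matrix (Fin m) (Fin n) F,
      IsMRD P.1 d ∧ P.2 ∈ P.1 then
    (h.choose.1 ∩ sphere h.choose.2 w).ncard
  else 0

/-! ### Channels and decoders -/

/-- `Q X` is the law of the received matrix when `X` is sent; the error is the received matrix
minus the sent one. The channel is an equal row space channel when any two errors with the same
row space have the same probability. -/
def IsEqualRowSpace
    (Q : Matrix (Fin m) (Fin n) F → PMF (Matrix (Fin m) (Fin n) F)) : Prop :=
  ∀ X E E', rowSpace E = rowSpace E' → Q X (X + E) = Q X (X + E')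

/-- `δ` is a bounded distance decoder of radius `t` for `𝒞`: given a received matrix `Y`, it
outputs a codeword at rank distance at most `t` from `Y` if there is one, and it declares a
failure (`none`) otherwise. -/
def IsBoundedDistanceDecoder (𝒞 : Set (Matrix (Fin m) (Fin n) F)) (t : ℕ)
    (δ : Matrix (Fin m) (Fin n) F → Option (Matrix (Fin m) (Fin n) F)) : Prop :=
  (∀ Y D, δ Y = some D → D ∈ 𝒞 ∧ rankDist Y D ≤ t) ∧
    ∀ Y, δ Y = none → ∀ D ∈ 𝒞, t < rankDist Y D

/-- The probability, when `C` is sent, that the error has row space `U`. -/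
def errorRowSpaceProb (Q : Matrix (Fin m) (Fin n) F → PMF (Matrix (Fin m) (Fin n) F))
    (C : Matrix (Fin m) (Fin n) F) (U : Submodule F (Fin n → F)) : ENNReal :=
  (Q C).toOuterMeasure {Y | rowSpace (Y - C) = U}

/-- The decoder error probability: the conditional probability, given that `C` is sent and that
the error has row space `U`, that the decoder `δ` outputs a codeword other than `C`. -/
def decoderErrorProb (Q : Matrix (Fin m) (Fin n) F → PMF (Matrix (Fin m) (Fin n) F))
    (δ : Matrix (Fin m) (Fin n) F → Option (Matrix (Fin m) (Fin n) F))
    (C : Matrix (Fin m) (Fin n) F) (U : Submodule F (Fin n → F)) : ℝ :=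
  ((Q C).toOuterMeasure {Y | rowSpace (Y - C) = U ∧ ∃ D, δ Y = some D ∧ D ≠ C} /
    errorRowSpaceProb Q C U).toReal

/-! ### The counts above do not depend on the representatives -/

theorem ncard_sphere (X : Matrix (Fin m) (Fin n) F) (u : ℕ) :
    (sphere X u).ncard = sphereCard F m n u := by
  unfold sphereCard
  refine Set.ncard_congr (fun Z _ => Z - X) ?_ ?_ ?_
  · intro Z hZ
    simpa [sphere, rankDist] using hZ
  · intro Z Z' _ _ h
    simpa using h
  · intro Z hZ
    exact ⟨Z + X, by simpa [sphere, rankDist] using hZ, by simp⟩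


theorem exists_equiv_of_range_eq {K V V' : Type*} [Field K] [AddCommGroup V] [AddCommGroup V']
    [Module K V] [Module K V'] [FiniteDimensional K V] (f g : V →ₗ[K] V')
    (h : LinearMap.range f = LinearMap.range g) : ∃ e : V ≃ₗ[K] V, ∀ x, g x = f (e x) := by
  obtain ⟨P, hP⟩ := Submodule.exists_isCompl (LinearMap.ker f)
  obtain ⟨P', hP'⟩ := Submodule.exists_isCompl (LinearMap.ker g)
  have hk : Module.finrank K (LinearMap.ker g) = Module.finrank K (LinearMap.ker f) := by
    have h1 := LinearMap.finrank_range_add_finrank_ker f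
    have h2 := LinearMap.finrank_range_add_finrank_ker g
    rw [h] at h1
    omega
  let k : LinearMap.ker g ≃ₗ[K] LinearMap.ker f := LinearEquiv.ofFinrankEq _ _ hk
  let c : P' ≃ₗ[K] P := (g.kerComplementEquivRange hP'.symm) ≪≫ₗ
    LinearEquiv.ofEq _ _ h.symm ≪≫ₗ (f.kerComplementEquivRange hP.symm).symm
  have hc : ∀ x : P', f (c x) = g x := by
    intro x
    have h1 : f.kerComplementEquivRange hP.symm (c x) =
        LinearEquiv.ofEq _ _ h.symm (g.kerComplementEquivRange hP'.symm x) := by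
      simp only [c, LinearEquiv.trans_apply, LinearEquiv.apply_symm_apply]
    have h2 := congrArg Subtype.val h1
    simpa using h2
  refine ⟨(Submodule.prodEquivOfIsCompl _ _ hP').symm ≪≫ₗ LinearEquiv.prodCongr k c ≪≫ₗ
    Submodule.prodEquivOfIsCompl _ _ hP, fun x => ?_⟩
  obtain ⟨⟨a, b⟩, rfl⟩ := (Submodule.prodEquivOfIsCompl _ _ hP').surjective x
  simp [hc]

theorem exists_mul_of_rowSpace_eq {R S : Matrix (Fin m) (Fin n) F}
    (h : rowSpace R = rowSpace S) :
    ∃ A B : Matrix (Fin m) (Fin m) F, A * B = 1 ∧ B * A = 1 ∧ S = A * R := by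
  obtain ⟨e, he⟩ := exists_equiv_of_range_eq R.vecMulLinear S.vecMulLinear
    (by rw [range_vecMulLinear, range_vecMulLinear]; exact h)
  refine ⟨(LinearMap.toMatrix' e.toLinearMap).transpose,
    (LinearMap.toMatrix' e.symm.toLinearMap).transpose, ?_, ?_, ?_⟩
  · rw [← Matrix.transpose_mul, ← LinearMap.toMatrix'_comp]; simp
  · rw [← Matrix.transpose_mul, ← LinearMap.toMatrix'_comp]; simp
  · ext i j
    have h1 := congrFun (he (Pi.single i 1)) j
    simp only [Matrix.coe_vecMulLinear, Matrix.single_one_vecMul] at h1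
    rw [show S i j = S.row i j from rfl, h1]
    simp [Matrix.mul_apply, Matrix.vecMul, dotProduct, LinearMap.toMatrix'_apply]


theorem rowSpace_mul_le {k : ℕ} (A : Matrix (Fin k) (Fin m) F) (X : Matrix (Fin m) (Fin n) F) :
    rowSpace (A * X) ≤ rowSpace X := by
  unfold rowSpace
  rw [← range_vecMulLinear, ← range_vecMulLinear]
  rintro _ ⟨v, rfl⟩
  exact ⟨Matrix.vecMul v A, by simp⟩

theorem rowSpace_mul_of_inv {A B : Matrix (Fin m) (Fin m) F} (h : B * A = 1)
    (X : Matrix (Fin m) (Fin n) F) : rowSpace (A * X) = rowSpace X := by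
  refine le_antisymm (rowSpace_mul_le A X) ?_
  have := rowSpace_mul_le B (A * X)
  rwa [← Matrix.mul_assoc, h, Matrix.one_mul] at this

theorem finrank_rowSpace (X : Matrix (Fin m) (Fin n) F) :
    Module.finrank F (rowSpace X) = X.rank := X.rank_eq_finrank_span_row.symm

theorem ncard_rowSpace_sphere_eq {R S : Matrix (Fin m) (Fin n) F} (h : rowSpace R = rowSpace S)
    (U : Submodule F (Fin n → F)) (s : ℕ) :
    {X : Matrix (Fin m) (Fin n) F | rowSpace X = U ∧ rankDist X R = s}.ncard =
      {X : Matrix (Fin m) (Fin n) F | rowSpace X = U ∧ rankDist X S = s}.ncard := by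
  obtain ⟨A, B, hAB, hBA, rfl⟩ := exists_mul_of_rowSpace_eq h
  have key : ∀ X, rankDist (A * X) (A * R) = rankDist X R := by
    intro X
    unfold rankDist
    rw [← Matrix.mul_sub, ← finrank_rowSpace, ← finrank_rowSpace, rowSpace_mul_of_inv hBA]
  refine Set.ncard_congr (fun X _ => A * X) ?_ ?_ ?_
  · rintro X ⟨h1, h2⟩
    exact ⟨by rw [rowSpace_mul_of_inv hBA, h1], by rw [key, h2]⟩
  · intro X Y _ _ hXY
    have := congrArg (B * ·) hXY
    simpa [← Matrix.mul_assoc, hBA] using this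
  · rintro X ⟨h1, h2⟩
    have hX : A * (B * X) = X := by rw [← Matrix.mul_assoc, hAB, Matrix.one_mul]
    refine ⟨B * X, ⟨by rw [rowSpace_mul_of_inv hAB, h1], ?_⟩, hX⟩
    rw [← key, hX, h2]

/-- `g_R(U, s, W)` can be computed with any matrix `R` with row space `W`. -/
theorem ncard_rowSpace_sphere (R : Matrix (Fin m) (Fin n) F) (U : Submodule F (Fin n → F))
    (s : ℕ) :
    {X : Matrix (Fin m) (Fin n) F | rowSpace X = U ∧ rankDist X R = s}.ncard =
      rowNum m U s (rowSpace R) := by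
  have h : ∃ R' : Matrix (Fin m) (Fin n) F, rowSpace R' = rowSpace R := ⟨R, rfl⟩
  rw [rowNum, dif_pos h]
  exact ncard_rowSpace_sphere_eq h.choose_spec.symm U s

theorem exists_mul_mul_of_rank_eq {R S : Matrix (Fin m) (Fin n) F} (h : R.rank = S.rank) :
    ∃ (A B : Matrix (Fin m) (Fin m) F) (P P' : Matrix (Fin n) (Fin n) F),
      A * B = 1 ∧ B * A = 1 ∧ P * P' = 1 ∧ P' * P = 1 ∧ S = A * R * P := by
  obtain ⟨g, hg⟩ := Submodule.exists_linearEquiv_restrict_eq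
    (LinearEquiv.ofFinrankEq (rowSpace R) (rowSpace S)
      (by rw [finrank_rowSpace, finrank_rowSpace, h]))
  let P := (LinearMap.toMatrix' g.toLinearMap).transpose
  let P' := (LinearMap.toMatrix' g.symm.toLinearMap).transpose
  have hP : P * P' = 1 := by
    rw [← Matrix.transpose_mul, ← LinearMap.toMatrix'_comp]; simp
  have hP' : P' * P = 1 := by
    rw [← Matrix.transpose_mul, ← LinearMap.toMatrix'_comp]; simp
  have hv : ∀ v, Matrix.vecMul v P = g v := by
    intro v
    rw [Matrix.vecMul_transpose, LinearMap.toMatrix'_mulVec]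
    rfl
  have hRS : rowSpace (R * P) = rowSpace S := by
    have hle : rowSpace (R * P) ≤ rowSpace S := by
      unfold rowSpace
      rw [← range_vecMulLinear]
      rintro _ ⟨v, rfl⟩
      have hm : Matrix.vecMul v R ∈ rowSpace R := by
        unfold rowSpace
        rw [← range_vecMulLinear]
        exact ⟨v, rfl⟩
      have h1 := hg ⟨_, hm⟩
      simp only [Matrix.coe_vecMulLinear, ← Matrix.vecMul_vecMul, hv]
      rw [← h1]
      exact Subtype.property _
    refine Submodule.eq_of_le_of_finrank_eq hle ?_
    rw [finrank_rowSpace, finrank_rowSpace, ← h]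
    refine Matrix.rank_mul_eq_left_of_isUnit_det P R ?_
    rw [← Matrix.isUnit_iff_isUnit_det]
    exact ⟨⟨P, P', hP, hP'⟩, rfl⟩
  obtain ⟨A, B, hAB, hBA, hS⟩ := exists_mul_of_rowSpace_eq hRS
  exact ⟨A, B, P, P', hAB, hBA, hP, hP', by rw [hS, Matrix.mul_assoc]⟩

/-- `J_R(u, s, w)` can be computed with any two centers at rank distance `w`. -/
theorem ncard_sphere_inter (X Y : Matrix (Fin m) (Fin n) F) (u s : ℕ) :
    (sphere X u ∩ sphere Y s).ncard = interNum F m n u s (rankDist X Y) := by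
  have h : ∃ P : Matrix (Fin m) (Fin n) F × Matrix (Fin m) (Fin n) F,
      rankDist P.1 P.2 = rankDist X Y := ⟨(X, Y), rfl⟩
  rw [interNum, dif_pos h]
  have hs := h.choose_spec
  generalize h.choose = Z at hs
  obtain ⟨X', Y'⟩ := Z
  obtain ⟨A, B, P, P', hAB, hBA, hP, hP', hE⟩ := exists_mul_mul_of_rank_eq
    (R := X - Y) (S := X' - Y') hs.symm
  have hrk : ∀ Z : Matrix (Fin m) (Fin n) F, (A * Z * P).rank = Z.rank := by
    intro Z
    rw [Matrix.rank_mul_eq_left_of_isUnit_det, Matrix.rank_mul_eq_right_of_isUnit_det]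
    · rw [← Matrix.isUnit_iff_isUnit_det]; exact ⟨⟨A, B, hAB, hBA⟩, rfl⟩
    · rw [← Matrix.isUnit_iff_isUnit_det]; exact ⟨⟨P, P', hP, hP'⟩, rfl⟩
  have hinv : ∀ Z : Matrix (Fin m) (Fin n) F, B * (A * Z * P) * P' = Z := by
    intro Z
    calc B * (A * Z * P) * P' = (B * A) * Z * (P * P') := by simp only [Matrix.mul_assoc]
      _ = Z := by rw [hBA, hP, Matrix.one_mul, Matrix.mul_one]
  have hinv' : ∀ Z : Matrix (Fin m) (Fin n) F, A * (B * Z * P') * P = Z := by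
    intro Z
    calc A * (B * Z * P') * P = (A * B) * Z * (P' * P) := by simp only [Matrix.mul_assoc]
      _ = Z := by rw [hAB, hP', Matrix.one_mul, Matrix.mul_one]
  have hY : ∀ Z, A * (Z - X) * P + X' - Y' = A * (Z - Y) * P := by
    intro Z
    rw [add_sub_assoc, hE, ← Matrix.add_mul, ← Matrix.mul_add, sub_add_sub_cancel]
  refine Set.ncard_congr (fun Z _ => A * (Z - X) * P + X') ?_ ?_ ?_
  · rintro Z ⟨h1, h2⟩
    simp only [sphere, rankDist, Set.mem_ofPred_eq, Set.mem_inter_iff] at h1 h2 ⊢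
    exact ⟨by rw [add_sub_cancel_right, hrk, h1], by rw [hY, hrk, h2]⟩
  · intro Z Z' _ _ hZ
    have h3 := add_right_cancel hZ
    have h4 := hinv (Z - X)
    rw [h3, hinv] at h4
    exact (sub_left_inj.1 h4).symm
  · rintro Z ⟨h1, h2⟩
    simp only [sphere, rankDist, Set.mem_ofPred_eq] at h1 h2
    have hZ : A * (B * (Z - X') * P' + X - X) * P + X' = Z := by
      rw [add_sub_cancel_right, hinv', sub_add_cancel]
    refine ⟨B * (Z - X') * P' + X, ⟨?_, ?_⟩, hZ⟩
    · simp only [sphere, rankDist, Set.mem_ofPred_eq]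
      rw [← hrk, ← h1]
      congr 1
      rw [add_sub_cancel_right, hinv']
    · simp only [sphere, rankDist, Set.mem_ofPred_eq]
      rw [← hrk, ← hY, hZ, h2]

end RankMetric

end

/-! The error is uniformly distributed over the `α(m, u)` matrices with row space `U`
(`decoderErrorProb_eq_ncard_div`), and the balls of radius `t` around the codewords are disjoint, so
the errors that lead to a wrong codeword are counted by summing `g_R(U, s, W)` over the codewords
`D ≠ C`, with `W` the row space of `D - C` (`ncard_decoder_error`). This gives the exact formula.

The step from `g_R` to `J_R` is a double count. Pairs of matrices of prescribed ranks `u`, `w` at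
distance `s` show that `N_R(w) J_R(u, s, w) = N_R(u) J_R(w, s, u)`, and the same pairs with the first
row space fixed show that `g_R(U, s, W)`, summed over the `w`-dimensional `W`, equals
`α(m, u) / N_R(u)` times `[n, w] J_R(u, s, w)` (`sum_rowNum`). Hence any bound or formula for
`A_W(C)` in terms of `dim W` can be substituted:

* In general `A_W(C) ≤ α(m, w - d + 1)`. Dividing `F ^ n` by a `(d - 1)`-dimensional subspace of `W`
  remains injective on the code and leaves matrices with a row space of dimension `w - d + 1`
  (`rowDistribution_le_alpha`).
* For a maximum rank distance code with `n ≤ m`, the same quotient map is bijective onto all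
  matrices, so the number of codewords `D` with the row space of `D - C` inside `W` depends only on
  `dim W`, and by induction so does `A_W(C)` (`IsMRD.rowDistribution_eq`). This does not need
  linearity, and it also shows that `M(d, w)` is well defined.

For the strict bounds, `K_q q ^ (m (d - 1)) α(m, w - d + 1) ≤ α(m, w)`. So, since
`N_R(w) = [n, w] α(m, w)`, the double count bounds the sum by `K_q⁻¹ q ^ (-m (d - 1))` times the
volume of a ball of radius `t`, and this volume is less than `K_q⁻¹ q ^ (t (m + n - t))`
(`sum_sphereCard_lt`).
-/

noncomputable section

namespace RankMetric

/-! ### Row spaces of products -/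

section RowSpace

variable {F : Type*} [Field F] {m n : ℕ}

theorem rowSpace_eq_range (X : Matrix (Fin m) (Fin n) F) :
    rowSpace X = LinearMap.range X.vecMulLinear := (range_vecMulLinear X).symm

theorem rowSpace_le_iff {X : Matrix (Fin m) (Fin n) F} {W : Submodule F (Fin n → F)} :
    rowSpace X ≤ W ↔ ∀ i, X i ∈ W := by
  rw [rowSpace, Submodule.span_le, Set.range_subset_iff]
  rfl

theorem rowSpace_mul {k : ℕ} (X : Matrix (Fin m) (Fin n) F) (Y : Matrix (Fin n) (Fin k) F) :
    rowSpace (X * Y) = (rowSpace X).map Y.vecMulLinear := by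
  rw [rowSpace_eq_range, rowSpace_eq_range, ← LinearMap.range_comp]
  congr 1
  refine LinearMap.ext fun v => ?_
  simp

theorem mul_eq_zero_iff_rowSpace_le {k : ℕ} {X : Matrix (Fin m) (Fin n) F}
    {Y : Matrix (Fin n) (Fin k) F} :
    X * Y = 0 ↔ rowSpace X ≤ LinearMap.ker Y.vecMulLinear := by
  rw [rowSpace_le_iff]
  exact ⟨fun h i => congrFun h i, fun h => funext fun i => h i⟩

theorem rowSpace_neg (X : Matrix (Fin m) (Fin n) F) : rowSpace (-X) = rowSpace X := by
  have key : ∀ Y : Matrix (Fin m) (Fin n) F, rowSpace (-Y) ≤ rowSpace Y := fun Y =>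
    rowSpace_le_iff.2 fun i => (rowSpace Y).neg_mem (rowSpace_le_iff.1 le_rfl i)
  refine le_antisymm (key X) ?_
  simpa using key (-X)

theorem rank_eq_zero_iff {X : Matrix (Fin m) (Fin n) F} : X.rank = 0 ↔ X = 0 := by
  refine ⟨fun h => ?_, fun h => by rw [h, Matrix.rank_zero]⟩
  rw [← finrank_rowSpace, Submodule.finrank_eq_zero] at h
  exact funext fun i => (Submodule.mem_bot F).1 (rowSpace_le_iff.1 h.le i)

theorem rankDist_comm (X Y : Matrix (Fin m) (Fin n) F) : rankDist X Y = rankDist Y X := by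
  rw [rankDist, rankDist, ← finrank_rowSpace, ← finrank_rowSpace, ← neg_sub, rowSpace_neg]

theorem rankDist_triangle (X Y Z : Matrix (Fin m) (Fin n) F) :
    rankDist X Z ≤ rankDist X Y + rankDist Y Z := by
  have h : rowSpace (X - Z) ≤ rowSpace (X - Y) ⊔ rowSpace (Y - Z) := by
    refine rowSpace_le_iff.2 fun i => ?_
    have hi : (X - Z) i = (X - Y) i + (Y - Z) i := by
      ext j; simp
    rw [hi]
    exact Submodule.add_mem_sup (rowSpace_le_iff.1 le_rfl i) (rowSpace_le_iff.1 le_rfl i)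
  simp only [rankDist, ← finrank_rowSpace]
  exact (Submodule.finrank_mono h).trans (Submodule.finrank_add_le_finrank_add_finrank _ _)

/-- Every subspace is the kernel of right multiplication by a matrix whose number of columns is
the codimension. -/
theorem exists_ker_vecMulLinear_eq (K : Submodule F (Fin n → F)) {k : ℕ}
    (hK : Module.finrank F K = k) :
    ∃ Y : Matrix (Fin n) (Fin (n - k)) F, LinearMap.ker Y.vecMulLinear = K := by
  have hfin : Module.finrank F ((Fin n → F) ⧸ K) = Module.finrank F (Fin (n - k) → F) := by
    have h := K.finrank_quotient_add_finrank
    rw [Module.finrank_fin_fun] at h ⊢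
    omega
  let f : (Fin n → F) →ₗ[F] (Fin (n - k) → F) :=
    (LinearEquiv.ofFinrankEq _ _ hfin).toLinearMap ∘ₗ K.mkQ
  refine ⟨(LinearMap.toMatrix' f).transpose, ?_⟩
  have hf : (LinearMap.toMatrix' f).transpose.vecMulLinear = f := by
    refine LinearMap.ext fun v => ?_
    change Matrix.vecMul v (LinearMap.toMatrix' f).transpose = f v
    rw [Matrix.vecMul_transpose, LinearMap.toMatrix'_mulVec]
  rw [hf, LinearMap.ker_comp, LinearEquiv.ker, Submodule.comap_bot, Submodule.ker_mkQ]

/-- A subspace can be enlarged, inside a larger one, to any intermediate dimension. -/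
theorem exists_finrank_eq_between {V : Type*} [AddCommGroup V] [Module F V]
    [FiniteDimensional F V] {A B : Submodule F V} (hAB : A ≤ B) {k : ℕ}
    (hA : Module.finrank F A ≤ k) (hB : k ≤ Module.finrank F B) :
    ∃ K : Submodule F V, A ≤ K ∧ K ≤ B ∧ Module.finrank F K = k := by
  induction k, hA using Nat.le_induction with
  | base => exact ⟨A, le_rfl, hAB, rfl⟩
  | succ k _ ih =>
    obtain ⟨K, hAK, hKB, hK⟩ := ih (by omega)
    have hlt : K < B := lt_of_le_of_ne hKB fun h => by rw [h] at hK; omega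
    obtain ⟨v, hvB, hvK⟩ := SetLike.exists_of_lt hlt
    refine ⟨K ⊔ F ∙ v, hAK.trans le_sup_left,
      sup_le hKB ((Submodule.span_singleton_le_iff_mem v B).2 hvB), ?_⟩
    rw [Submodule.finrank_sup_span_singleton hvK, hK]

theorem ncard_rowSpace_le (m : ℕ) (W : Submodule F (Fin n → F)) :
    {X : Matrix (Fin m) (Fin n) F | rowSpace X ≤ W}.ncard =
      Nat.card F ^ (m * Module.finrank F W) := by
  have e : {X : Matrix (Fin m) (Fin n) F | rowSpace X ≤ W} ≃ (Fin m → W) :=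
    { toFun := fun X i => ⟨X.1 i, rowSpace_le_iff.1 X.2 i⟩
      invFun := fun f => ⟨fun i => f i, rowSpace_le_iff.2 fun i => (f i).2⟩
      left_inv := fun _ => rfl
      right_inv := fun _ => rfl }
  rw [← Nat.card_coe_set_eq, Nat.card_congr e, Nat.card_fun, Nat.card_fin,
    Module.natCard_eq_pow_finrank (K := F), ← pow_mul, mul_comm]

end RowSpace

/-! ### Counting matrices by row space -/

section Counting

variable {F : Type*} [Field F] [Finite F] {m n : ℕ}

theorem mem_grassmannian {w : ℕ} {W : Submodule F (Fin n → F)} :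
    W ∈ grassmannian F n w ↔ Module.finrank F W = w := by
  simp [grassmannian]

/-- A matrix with `u` columns, in the form `vᵀ`, has full row space exactly when the `u` vectors
`v i` are linearly independent. -/
theorem rowSpace_transpose_eq_top_iff {u : ℕ} (v : Fin u → Fin m → F) :
    rowSpace (Matrix.of v).transpose = ⊤ ↔ LinearIndependent F v := by
  rw [linearIndependent_iff_card_eq_finrank_span, Fintype.card_fin]
  have h : Module.finrank F (rowSpace (Matrix.of v).transpose) =
      Set.finrank F (Set.range v) := by
    rw [finrank_rowSpace, Matrix.rank_eq_finrank_span_cols]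
    rfl
  rw [← h]
  constructor
  · intro h1
    rw [h1, finrank_top, Module.finrank_fin_fun]
  · intro h1
    refine Submodule.eq_top_of_finrank_eq ?_
    rw [← h1, Module.finrank_fin_fun]

theorem card_linearIndependent_eq_alpha (F : Type*) [Field F] [Finite F] (k u : ℕ) :
    (Nat.card {v : Fin u → Fin k → F // LinearIndependent F v} : ℝ) =
      alpha (Nat.card F) k u := by
  have := Fintype.ofFinite F
  rcases le_or_gt u k with h | h
  · rw [card_linearIndependent (by simpa using h), Module.finrank_fin_fun, alpha,
      ← Fin.prod_univ_eq_prod_range (fun i => ((Nat.card F : ℝ) ^ k - (Nat.card F : ℝ) ^ i)) u,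
      Nat.cast_prod, Nat.card_eq_fintype_card]
    refine Finset.prod_congr rfl fun i _ => ?_
    rw [Nat.cast_sub (Nat.pow_le_pow_right Fintype.card_pos (by omega))]
    push_cast
    rfl
  · have hempty : IsEmpty {v : Fin u → Fin k → F // LinearIndependent F v} := by
      refine ⟨fun v => ?_⟩
      have := v.2.fintype_card_le_finrank
      rw [Fintype.card_fin, Module.finrank_fin_fun] at this
      omega
    rw [Nat.card_of_isEmpty, alpha, Finset.prod_eq_zero (Finset.mem_range.2 h) (sub_self _)]
    simp

/-- There are `α(m, dim U)` matrices with row space `U`: they are the products `Y * G`, where the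
rows of `G` form a basis of `U` and the columns of `Y` are linearly independent. -/
theorem ncard_rowSpace_eq (m : ℕ) (U : Submodule F (Fin n → F)) :
    ({X : Matrix (Fin m) (Fin n) F | rowSpace X = U}.ncard : ℝ) =
      alpha (Nat.card F) m (Module.finrank F U) := by
  let b := Module.finBasis F U
  let G : Matrix (Fin (Module.finrank F U)) (Fin n) F := Matrix.of fun i => (b i : Fin n → F)
  have hG : Function.Injective G.vecMulLinear := by
    have hli : LinearIndependent F G.row :=
      b.linearIndependent.map' U.subtype (Submodule.ker_subtype U)
    exact Matrix.vecMul_injective_iff.2 hli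
  have hGU : rowSpace G = U := by
    have h1 : Set.range G.row = U.subtype '' Set.range b := by
      rw [← Set.range_comp]; rfl
    rw [rowSpace, h1, Submodule.span_image, b.span_eq, Submodule.map_top, Submodule.range_subtype]
  have himg : {X : Matrix (Fin m) (Fin n) F | rowSpace X = U} =
      (fun v => (Matrix.of v).transpose * G) ''
        {v : Fin (Module.finrank F U) → Fin m → F | LinearIndependent F v} := by
    ext X
    constructor
    · intro hX
      have hrow : ∀ i, ∃ y, G.vecMulLinear y = X i := by
        intro i
        have h1 : X i ∈ rowSpace X := rowSpace_le_iff.1 le_rfl i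
        rw [show rowSpace X = U from hX, ← hGU, rowSpace_eq_range] at h1
        exact h1
      choose y hy using hrow
      have hXY : (Matrix.of (Matrix.of y).transpose).transpose * G = X := by
        funext i
        exact hy i
      refine ⟨(Matrix.of y).transpose, (rowSpace_transpose_eq_top_iff _).1 ?_, hXY⟩
      refine Submodule.map_injective_of_injective hG ?_
      rw [← rowSpace_mul, hXY, Submodule.map_top, ← rowSpace_eq_range, hGU]
      exact hX
    · rintro ⟨v, hv, rfl⟩
      change rowSpace _ = U
      rw [rowSpace_mul, (rowSpace_transpose_eq_top_iff v).2 hv, Submodule.map_top,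
        ← rowSpace_eq_range, hGU]
  have hinj : Function.Injective
      (fun v : Fin (Module.finrank F U) → Fin m → F => (Matrix.of v).transpose * G) := by
    intro v v' h
    have h1 : (Matrix.of v).transpose = (Matrix.of v').transpose :=
      funext fun i => hG (congrFun h i)
    exact Matrix.transpose_injective h1
  rw [himg, Set.ncard_image_of_injective _ hinj, ← card_linearIndependent_eq_alpha]
  rfl

theorem alpha_pos {q k u : ℕ} (hq : 2 ≤ q) (h : u ≤ k) : 0 < alpha q k u := by
  refine Finset.prod_pos fun i hi => sub_pos.2 ?_
  exact pow_lt_pow_right₀ (by exact_mod_cast hq) ((Finset.mem_range.1 hi).trans_le h)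

theorem two_le_natCard (F : Type*) [Field F] [Finite F] : 2 ≤ Nat.card F :=
  Finite.one_lt_card

theorem exists_rowSpace_eq {U : Submodule F (Fin n → F)} (hU : Module.finrank F U ≤ m) :
    ∃ X : Matrix (Fin m) (Fin n) F, rowSpace X = U := by
  have h := alpha_pos (two_le_natCard F) hU
  rw [← ncard_rowSpace_eq m U, Nat.cast_pos] at h
  exact Set.nonempty_of_ncard_ne_zero h.ne'

end Counting

/-! ### Double counting in the rank metric -/

section DoubleCounting

theorem ncard_eq_sum_ncard_fiber {α β : Type*} [Finite α] [DecidableEq β] (p : α → Prop)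
    (g : α → β) (s : Finset β) (h : ∀ a, p a → g a ∈ s) :
    {a | p a}.ncard = ∑ b ∈ s, {a | p a ∧ g a = b}.ncard := by
  classical
  have := Fintype.ofFinite α
  have hc : ∀ r : α → Prop, {a | r a}.ncard = (Finset.univ.filter r).card := fun r => by
    rw [← Set.ncard_coe_finset]; simp
  simp only [hc]
  rw [Finset.card_eq_sum_card_fiberwise (f := g) (t := s) fun a ha => h a (by simpa using ha)]
  simp only [Finset.filter_filter]
  exact Finset.sum_congr rfl fun b _ => by congr

/-- If every `a` with `p a` is related to exactly `c` elements, then there are `c` times as many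
related pairs as there are such `a`. -/
theorem ncard_pairs {α β : Type*} [Finite α] [Finite β] (p : α → Prop) (r : α → β → Prop)
    (c : ℕ) (h : ∀ a, p a → {b | r a b}.ncard = c) :
    {x : α × β | p x.1 ∧ r x.1 x.2}.ncard = {a | p a}.ncard * c := by
  classical
  have := Fintype.ofFinite α
  have hfst : {a | p a}.ncard = (Finset.univ.filter p).card := by
    rw [← Set.ncard_coe_finset]; simp
  rw [ncard_eq_sum_ncard_fiber _ Prod.fst (Finset.univ.filter p) fun x hx => by simpa using hx.1,
    hfst, Finset.sum_const_nat]
  intro a ha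
  have ha : p a := by simpa using ha
  rw [← h a ha, ← Set.ncard_image_of_injective {b | r a b} (Prod.mk_right_injective a)]
  congr 1
  ext ⟨a', b⟩
  simp only [Set.mem_ofPred_eq, Set.mem_image, Prod.mk.injEq]
  constructor
  · rintro ⟨⟨_, h2⟩, rfl⟩
    exact ⟨b, h2, rfl, rfl⟩
  · rintro ⟨b', hb, rfl, rfl⟩
    exact ⟨⟨ha, hb⟩, rfl⟩

theorem ncard_swap {α β : Type*} (r : α → β → Prop) :
    {x : α × β | r x.1 x.2}.ncard = {y : β × α | r y.2 y.1}.ncard :=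
  Set.ncard_congr (fun x _ => x.swap) (fun _ h => h) (fun _ _ _ _ h => Prod.swap_injective h)
    fun y h => ⟨y.swap, h, y.swap_swap⟩

variable {F : Type*} [Field F] {m n : ℕ}

theorem sphereCard_eq_ncard_rank (F : Type*) [Field F] (m n w : ℕ) :
    sphereCard F m n w = {X : Matrix (Fin m) (Fin n) F | X.rank = w}.ncard := by
  simp [sphereCard, sphere, rankDist]

theorem ncard_rank_eq_rankDist_eq {R : Matrix (Fin m) (Fin n) F} {w : ℕ} (hR : R.rank = w)
    (u s : ℕ) :
    {E : Matrix (Fin m) (Fin n) F | E.rank = u ∧ rankDist E R = s}.ncard =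
      interNum F m n u s w := by
  have h := ncard_sphere_inter 0 R u s
  rw [rankDist_comm, rankDist, sub_zero, hR] at h
  rw [← h]
  congr 1
  ext E
  simp [sphere, rankDist]

theorem interNum_eq_zero_of_lt {w : ℕ} (hw : m < w) (u s : ℕ) : interNum F m n u s w = 0 := by
  rw [interNum, dif_neg]
  rintro ⟨P, hP⟩
  have h := (P.1 - P.2).rank_le_height
  rw [rankDist] at hP
  omega

theorem rowNum_eq_zero_of_lt {W : Submodule F (Fin n → F)} (hw : m < Module.finrank F W)
    (U : Submodule F (Fin n → F)) (s : ℕ) : rowNum m U s W = 0 := by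
  rw [rowNum, dif_neg]
  rintro ⟨R, rfl⟩
  rw [finrank_rowSpace] at hw
  have h := R.rank_le_height
  omega

variable [Finite F]

theorem sphereCard_eq_sum_grassmannian (F : Type*) [Field F] [Finite F] (m n w : ℕ) :
    sphereCard F m n w = ∑ W ∈ grassmannian F n w,
      {X : Matrix (Fin m) (Fin n) F | rowSpace X = W}.ncard := by
  classical
  rw [sphereCard_eq_ncard_rank, ncard_eq_sum_ncard_fiber _ rowSpace (grassmannian F n w)
    fun X hX => by rw [mem_grassmannian, finrank_rowSpace, hX]]
  refine Finset.sum_congr rfl fun W hW => ?_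
  congr 1
  ext X
  refine ⟨fun h => h.2, fun h => ⟨?_, h⟩⟩
  rw [← finrank_rowSpace, show rowSpace X = W from h]
  exact mem_grassmannian.1 hW

theorem sphereCard_eq_card_mul_alpha (F : Type*) [Field F] [Finite F] (m n w : ℕ) :
    (sphereCard F m n w : ℝ) = (grassmannian F n w).card * alpha (Nat.card F) m w := by
  rw [sphereCard_eq_sum_grassmannian, Nat.cast_sum, Finset.sum_congr rfl fun W hW => by
    rw [ncard_rowSpace_eq, mem_grassmannian.1 hW], Finset.sum_const, nsmul_eq_mul]

/-- The Grassmannian has Gaussian binomial cardinality: the `w × n` matrices of rank `w` are the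
transposes of the `n × w` matrices with row space `F ^ w`. -/
theorem card_grassmannian (F : Type*) [Field F] [Finite F] (n w : ℕ) :
    ((grassmannian F n w).card : ℝ) = gaussBinom (Nat.card F) n w := by
  have h1 := sphereCard_eq_card_mul_alpha F w n w
  have h2 : (sphereCard F w n w : ℝ) = alpha (Nat.card F) n w := by
    have h3 := ncard_rowSpace_eq n (⊤ : Submodule F (Fin w → F))
    rw [finrank_top, Module.finrank_fin_fun] at h3
    rw [← h3, sphereCard_eq_ncard_rank,
      ← Set.ncard_image_of_injective _ (Matrix.transpose_injective (α := F))]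
    congr 2
    ext X
    simp only [Set.mem_image, Set.mem_ofPred_eq]
    constructor
    · rintro ⟨Y, hY, rfl⟩
      refine Submodule.eq_top_of_finrank_eq ?_
      rw [finrank_rowSpace, Matrix.rank_transpose, hY, Module.finrank_fin_fun]
    · intro hX
      refine ⟨X.transpose, ?_, X.transpose_transpose⟩
      rw [Matrix.rank_transpose, ← finrank_rowSpace, hX, finrank_top, Module.finrank_fin_fun]
  rw [gaussBinom, ← h2, h1, mul_div_cancel_right₀]
  exact (alpha_pos (two_le_natCard F) le_rfl).ne'

/-- Both sides count the pairs of matrices of ranks `w` and `u` at rank distance `s`. -/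
theorem sphereCard_mul_interNum (F : Type*) [Field F] [Finite F] (m n u s w : ℕ) :
    sphereCard F m n w * interNum F m n u s w = sphereCard F m n u * interNum F m n w s u := by
  rw [sphereCard_eq_ncard_rank, sphereCard_eq_ncard_rank,
    ← ncard_pairs (fun R : Matrix (Fin m) (Fin n) F => R.rank = w)
      (fun R E => E.rank = u ∧ rankDist E R = s) _ fun R hR => ncard_rank_eq_rankDist_eq hR u s,
    ← ncard_pairs (fun R : Matrix (Fin m) (Fin n) F => R.rank = u)
      (fun R E => E.rank = w ∧ rankDist E R = s) _ fun R hR => ncard_rank_eq_rankDist_eq hR w s,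
    ncard_swap fun R E : Matrix (Fin m) (Fin n) F =>
      R.rank = w ∧ E.rank = u ∧ rankDist E R = s]
  congr 1
  ext x
  simp only [Set.mem_ofPred_eq, rankDist_comm x.1 x.2]
  tauto

/-- Both sides count the pairs of a matrix with row space `U` and a matrix of rank `w` at rank
distance `s`. -/
theorem alpha_mul_interNum (m : ℕ) (U : Submodule F (Fin n → F)) (s w : ℕ) :
    alpha (Nat.card F) m (Module.finrank F U) * (interNum F m n w s (Module.finrank F U) : ℝ) =
      alpha (Nat.card F) m w * ∑ W ∈ grassmannian F n w, (rowNum m U s W : ℝ) := by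
  classical
  have h1 := ncard_pairs (fun E : Matrix (Fin m) (Fin n) F => rowSpace E = U)
    (fun E R => R.rank = w ∧ rankDist R E = s) (interNum F m n w s (Module.finrank F U))
    fun E hE => ncard_rank_eq_rankDist_eq (by rw [← finrank_rowSpace, hE]) w s
  have h2 := ncard_eq_sum_ncard_fiber
    (fun x : Matrix (Fin m) (Fin n) F × Matrix (Fin m) (Fin n) F =>
      rowSpace x.1 = U ∧ x.2.rank = w ∧ rankDist x.2 x.1 = s) (fun x => rowSpace x.2)
    (grassmannian F n w) fun x hx => by rw [mem_grassmannian, finrank_rowSpace, hx.2.1]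
  rw [h1] at h2
  rw [← ncard_rowSpace_eq m U, ← Nat.cast_mul, h2, Nat.cast_sum, Finset.mul_sum]
  refine Finset.sum_congr rfl fun W hW => ?_
  have hw := mem_grassmannian.1 hW
  have h3 := ncard_pairs (fun R : Matrix (Fin m) (Fin n) F => rowSpace R = W)
    (fun R E => rowSpace E = U ∧ rankDist E R = s) (rowNum m U s W)
    fun R hR => by rw [ncard_rowSpace_sphere, hR]
  rw [← hw, ← ncard_rowSpace_eq m W, ← Nat.cast_mul, ← h3,
    ncard_swap fun R E : Matrix (Fin m) (Fin n) F =>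
      rowSpace R = W ∧ rowSpace E = U ∧ rankDist E R = s]
  congr 2
  ext x
  simp only [Set.mem_ofPred_eq, rankDist_comm x.2 x.1, ← finrank_rowSpace]
  constructor
  · rintro ⟨⟨a, b, c⟩, e⟩
    exact ⟨e, a, c⟩
  · rintro ⟨e, a, c⟩
    exact ⟨⟨a, by rw [e], c⟩, e⟩

theorem sphereCard_pos {u : ℕ} (hm : u ≤ m) (hn : u ≤ n) : 0 < sphereCard F m n u := by
  obtain ⟨U, -, -, hU⟩ := exists_finrank_eq_between (bot_le (a := (⊤ : Submodule F (Fin n → F))))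
    (k := u) (by simp) (by simpa using hn)
  obtain ⟨X, hX⟩ := exists_rowSpace_eq (m := m) (U := U) (by omega)
  rw [sphereCard_eq_ncard_rank, Set.ncard_pos]
  exact ⟨X, by rw [Set.mem_ofPred_eq, ← finrank_rowSpace, hX, hU]⟩

/-- Summed over all `W` of dimension `w`, `g_R(U, s, W)` reduces to `J_R(u, s, w)`. Both sides
vanish when `w > m`; otherwise the two double counts combine. -/
theorem sum_rowNum (U : Submodule F (Fin n → F)) (hU : Module.finrank F U ≤ m) (s w : ℕ) :
    1 / alpha (Nat.card F) m (Module.finrank F U) *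
        ∑ W ∈ grassmannian F n w, (rowNum m U s W : ℝ) =
      1 / (sphereCard F m n (Module.finrank F U) : ℝ) *
        (gaussBinom (Nat.card F) n w * interNum F m n (Module.finrank F U) s w) := by
  rcases lt_or_ge m w with hw | hw
  · rw [interNum_eq_zero_of_lt hw, Finset.sum_eq_zero fun W hW => by
      rw [rowNum_eq_zero_of_lt (by rw [mem_grassmannian.1 hW]; exact hw), Nat.cast_zero]]
    simp
  have hαu := alpha_pos (two_le_natCard F) hU
  have hαw := alpha_pos (two_le_natCard F) hw
  have hN : (0 : ℝ) < sphereCard F m n (Module.finrank F U) := by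
    exact_mod_cast sphereCard_pos hU (by simpa using U.finrank_le)
  have h1 := alpha_mul_interNum m U s w
  have h2 : (sphereCard F m n w * interNum F m n (Module.finrank F U) s w : ℝ) =
      sphereCard F m n (Module.finrank F U) * interNum F m n w s (Module.finrank F U) := by
    exact_mod_cast sphereCard_mul_interNum F m n (Module.finrank F U) s w
  rw [sphereCard_eq_card_mul_alpha F m n w, card_grassmannian] at h2
  rw [one_div_mul_eq_div, one_div_mul_eq_div, div_eq_div_iff hαu.ne' hN.ne']
  refine mul_left_cancel₀ hαw.ne' ?_
  linear_combination (-(sphereCard F m n (Module.finrank F U) : ℝ)) * h1 -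
    alpha (Nat.card F) m (Module.finrank F U) * h2

end DoubleCounting

/-! ### The constant `K_q` and the volume of a ball -/

section Bounds

theorem one_sub_inv_pow_mem {q : ℕ} (hq : 2 ≤ q) (j : ℕ) :
    0 < 1 - ((q : ℝ) ^ (j + 1))⁻¹ ∧ 1 - ((q : ℝ) ^ (j + 1))⁻¹ < 1 := by
  have hq' : (1 : ℝ) < q := by exact_mod_cast hq
  have h1 : 1 < (q : ℝ) ^ (j + 1) := one_lt_pow₀ hq' (by omega)
  exact ⟨sub_pos.2 (inv_lt_one_of_one_lt₀ h1), sub_lt_self _ (by positivity)⟩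

theorem summable_log_Kq {q : ℕ} (hq : 2 ≤ q) :
    Summable fun j : ℕ => Real.log (1 - ((q : ℝ) ^ (j + 1))⁻¹) := by
  have hq' : (1 : ℝ) < q := by exact_mod_cast hq
  have hs : Summable fun j : ℕ => -((q : ℝ) ^ (j + 1))⁻¹ := by
    have h := summable_geometric_of_lt_one (r := ((q : ℝ))⁻¹) (by positivity)
      (inv_lt_one_of_one_lt₀ hq')
    have h2 := ((summable_nat_add_iff 1).2 h).neg
    simpa only [inv_pow] using h2
  simpa only [sub_eq_add_neg] using Real.summable_log_one_add_of_summable hs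

theorem exp_tsum_log_eq_Kq {q : ℕ} (hq : 2 ≤ q) :
    Real.exp (∑' j : ℕ, Real.log (1 - ((q : ℝ) ^ (j + 1))⁻¹)) = Kq q :=
  Real.rexp_tsum_eq_tprod (fun j => (one_sub_inv_pow_mem hq j).1) (summable_log_Kq hq)

theorem Kq_pos {q : ℕ} (hq : 2 ≤ q) : 0 < Kq q := by
  rw [← exp_tsum_log_eq_Kq hq]
  exact Real.exp_pos _

theorem Kq_lt_prod {q : ℕ} (hq : 2 ≤ q) (s : Finset ℕ) :
    Kq q < ∏ j ∈ s, (1 - ((q : ℝ) ^ (j + 1))⁻¹) := by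
  have hneg : ∀ j, Real.log (1 - ((q : ℝ) ^ (j + 1))⁻¹) < 0 := fun j =>
    Real.log_neg (one_sub_inv_pow_mem hq j).1 (one_sub_inv_pow_mem hq j).2
  rw [← exp_tsum_log_eq_Kq hq, ← Real.exp_log (Finset.prod_pos fun j _ =>
    (one_sub_inv_pow_mem hq j).1), Real.log_prod fun j _ => (one_sub_inv_pow_mem hq j).1.ne',
    Real.exp_lt_exp]
  obtain ⟨i, hi⟩ := s.exists_notMem
  have h1 := (summable_log_Kq hq).neg.sum_le_tsum (insert i s) fun j _ => by
    simpa using (hneg j).le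
  rw [tsum_neg, Finset.sum_neg_distrib, Finset.sum_insert hi] at h1
  linarith [hneg i]

/-- A partial product of `α(m, b)` over the indices `a, …, b - 1` loses at most the factor `K_q`
against `q ^ m` to the power of the number of factors. -/
theorem Kq_mul_pow_lt_prod_Ico {q : ℕ} (hq : 2 ≤ q) {m a b : ℕ} (hb : b ≤ m) :
    Kq q * (q : ℝ) ^ (m * (b - a)) < ∏ i ∈ Finset.Ico a b, ((q : ℝ) ^ m - (q : ℝ) ^ i) := by
  have hq' : (0 : ℝ) < q := by exact_mod_cast (by omega : 0 < q)
  have h1 : ∏ i ∈ Finset.Ico a b, ((q : ℝ) ^ m - (q : ℝ) ^ i) =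
      (q : ℝ) ^ (m * (b - a)) *
        ∏ j ∈ (Finset.Ico a b).image (fun i => m - 1 - i), (1 - ((q : ℝ) ^ (j + 1))⁻¹) := by
    rw [Finset.prod_image, pow_mul, ← Nat.card_Ico a b, ← Finset.prod_const,
      ← Finset.prod_mul_distrib]
    · refine Finset.prod_congr rfl fun i hi => ?_
      rw [Finset.mem_Ico] at hi
      have h2 : (q : ℝ) ^ m = (q : ℝ) ^ (m - 1 - i + 1) * (q : ℝ) ^ i := by
        rw [← pow_add]; congr 1; omega
      rw [h2]
      field_simp
    · intro i hi j hj hij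
      simp only [Finset.coe_Ico, Set.mem_Ico] at hi hj
      simp only at hij
      omega
  rw [h1, mul_comm]
  exact mul_lt_mul_of_pos_left (Kq_lt_prod hq _) (by positivity)

theorem Kq_mul_pow_mul_alpha_le {q : ℕ} (hq : 2 ≤ q) {m d w : ℕ} (hd : 0 < d) (hdw : d ≤ w)
    (hw : w ≤ m) :
    Kq q * (q : ℝ) ^ (m * (d - 1)) * alpha q m (w - d + 1) ≤ alpha q m w := by
  have h1 := Kq_mul_pow_lt_prod_Ico hq (a := w - d + 1) hw
  rw [show w - (w - d + 1) = d - 1 by omega] at h1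
  have h2 : alpha q m (w - d + 1) * ∏ i ∈ Finset.Ico (w - d + 1) w, ((q : ℝ) ^ m - (q : ℝ) ^ i) =
      alpha q m w := Finset.prod_range_mul_prod_Ico _ (by omega)
  rw [← h2, mul_comm]
  exact mul_le_mul_of_nonneg_left h1.le (alpha_pos hq (by omega)).le

theorem alpha_le_pow {q n u : ℕ} (hq : 2 ≤ q) (h : u ≤ n) : alpha q n u ≤ (q : ℝ) ^ (n * u) := by
  have hq' : (1 : ℝ) < q := by exact_mod_cast hq
  rw [pow_mul, alpha, ← Finset.card_range u, ← Finset.prod_const, Finset.card_range]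
  refine Finset.prod_le_prod (fun i hi => sub_nonneg.2 ?_) fun i _ => ?_
  · exact pow_le_pow_right₀ hq'.le ((Finset.mem_range.1 hi).le.trans h)
  · exact sub_le_self _ (by positivity)

theorem gaussBinom_lt {q n t : ℕ} (hq : 2 ≤ q) (h : t ≤ n) :
    gaussBinom q n t < (Kq q)⁻¹ * (q : ℝ) ^ (t * (n - t)) := by
  have hq' : (0 : ℝ) < q := by exact_mod_cast (by omega : 0 < q)
  have hK := Kq_pos hq
  have h1 : Kq q * (q : ℝ) ^ (t * t) < alpha q t t := by
    have h2 := Kq_mul_pow_lt_prod_Ico hq (a := 0) (le_refl t)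
    rwa [Nat.sub_zero, Nat.Ico_zero_eq_range] at h2
  rw [gaussBinom, div_lt_iff₀ (alpha_pos hq le_rfl)]
  refine (alpha_le_pow hq h).trans_lt ?_
  have h3 : (q : ℝ) ^ (n * t) =
      (Kq q)⁻¹ * (q : ℝ) ^ (t * (n - t)) * (Kq q * (q : ℝ) ^ (t * t)) := by
    have h4 : n * t = t * (n - t) + t * t := by
      rw [← mul_add, Nat.sub_add_cancel h, mul_comm]
    rw [h4, pow_add]
    field_simp
  rw [h3]
  exact mul_lt_mul_of_pos_left h1 (by positivity)

/-- The volume of a ball of radius `t ≤ n`. A matrix of rank at most `t` has its row space in a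
subspace of dimension exactly `t`, and `q ^ (m t)` matrices have it in a given one. -/
theorem sum_sphereCard_lt (F : Type*) [Field F] [Finite F] (m : ℕ) {n t : ℕ} (h : t ≤ n) :
    ∑ s ∈ Finset.range (t + 1), (sphereCard F m n s : ℝ) <
      (Kq (Nat.card F))⁻¹ * (Nat.card F : ℝ) ^ (t * (n - t) + m * t) := by
  have hq := two_le_natCard F
  have h1 : ∑ s ∈ Finset.range (t + 1), sphereCard F m n s =
      {X : Matrix (Fin m) (Fin n) F | X.rank ≤ t}.ncard := by
    rw [ncard_eq_sum_ncard_fiber _ Matrix.rank (Finset.range (t + 1))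
      fun X hX => Finset.mem_range.2 (Nat.lt_succ_of_le hX)]
    refine Finset.sum_congr rfl fun s hs => ?_
    rw [sphereCard_eq_ncard_rank]
    congr 1
    ext X
    have := Finset.mem_range.1 hs
    simp only [Set.mem_ofPred_eq]
    omega
  have h2 : {X : Matrix (Fin m) (Fin n) F | X.rank ≤ t} ⊆
      ⋃ W ∈ grassmannian F n t, {X : Matrix (Fin m) (Fin n) F | rowSpace X ≤ W} := by
    intro X hX
    obtain ⟨W, hXW, -, hW⟩ := exists_finrank_eq_between (le_top (a := rowSpace X)) (k := t)
      (by rw [finrank_rowSpace]; exact hX) (by simpa using h)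
    exact Set.mem_biUnion (mem_grassmannian.2 hW) hXW
  have h3 : {X : Matrix (Fin m) (Fin n) F | X.rank ≤ t}.ncard ≤
      (grassmannian F n t).card * Nat.card F ^ (m * t) := by
    refine (Set.ncard_le_ncard h2 (Set.toFinite _)).trans ?_
    refine (Finset.set_ncard_biUnion_le _ _).trans ?_
    rw [Finset.sum_const_nat fun W hW => by rw [ncard_rowSpace_le, mem_grassmannian.1 hW]]
  have h4 : ∑ s ∈ Finset.range (t + 1), (sphereCard F m n s : ℝ) ≤
      gaussBinom (Nat.card F) n t * (Nat.card F : ℝ) ^ (m * t) := by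
    rw [← card_grassmannian]
    rw [← h1] at h3
    exact_mod_cast h3
  refine h4.trans_lt ?_
  rw [pow_add, ← mul_assoc]
  have hq' : (0 : ℝ) < Nat.card F := by exact_mod_cast (by omega : 0 < Nat.card F)
  exact mul_lt_mul_of_pos_right (gaussBinom_lt hq h) (by positivity)

/-- The left side counts matrices at distance `s` from a fixed matrix of rank `u`, by their rank;
there are `N_R(s)` of these in total. -/
theorem sum_interNum_le (F : Type*) [Field F] [Finite F] {m n u : ℕ} (hm : u ≤ m) (hn : u ≤ n)
    (s : ℕ) (I : Finset ℕ) : ∑ w ∈ I, interNum F m n w s u ≤ sphereCard F m n s := by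
  obtain ⟨R, hR⟩ : {X : Matrix (Fin m) (Fin n) F | X.rank = u}.Nonempty := by
    refine Set.nonempty_of_ncard_ne_zero ?_
    rw [← sphereCard_eq_ncard_rank]
    exact (sphereCard_pos hm hn).ne'
  have h1 := ncard_eq_sum_ncard_fiber (fun X : Matrix (Fin m) (Fin n) F =>
    X.rank ∈ I ∧ rankDist X R = s) Matrix.rank I fun X hX => hX.1
  calc ∑ w ∈ I, interNum F m n w s u
      = {X : Matrix (Fin m) (Fin n) F | X.rank ∈ I ∧ rankDist X R = s}.ncard := by
        rw [h1]
        refine Finset.sum_congr rfl fun w hw => ?_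
        rw [← ncard_rank_eq_rankDist_eq hR]
        congr 1
        ext X
        simp only [Set.mem_ofPred_eq]
        constructor
        · rintro ⟨h2, h3⟩
          exact ⟨⟨h2 ▸ hw, h3⟩, h2⟩
        · rintro ⟨⟨_, h3⟩, h2⟩
          exact ⟨h2, h3⟩
    _ ≤ (sphere R s).ncard := Set.ncard_le_ncard (fun X hX => hX.2) (Set.toFinite _)
    _ = sphereCard F m n s := ncard_sphere R s

/-- The two strict bounds are the cases `d - 1 = 2 t` and `d - 1 = 2 t + 1`. -/
theorem error_bound_lt (F : Type*) [Field F] [Finite F] {m n d u t : ℕ} (hd : 0 < d) (ht : t ≤ n)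
    (hm : u ≤ m) (hn : u ≤ n) :
    1 / (sphereCard F m n u : ℝ) *
        ∑ w ∈ Finset.Icc d n, gaussBinom (Nat.card F) n w * alpha (Nat.card F) m (w - d + 1) *
          ∑ s ∈ Finset.range (t + 1), (interNum F m n u s w : ℝ) <
      Kq (Nat.card F) ^ (-2 : ℤ) *
        (Nat.card F : ℝ) ^ ((t : ℤ) * (m + n - t) - (m : ℤ) * (d - 1)) := by
  have hq := two_le_natCard F
  have hq' : (0 : ℝ) < Nat.card F := by exact_mod_cast (by omega : 0 < Nat.card F)
  have hN : (0 : ℝ) < sphereCard F m n u := by exact_mod_cast sphereCard_pos hm hn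
  have hK := Kq_pos hq
  set q := Nat.card F with hqdef
  set c : ℝ := (Kq q * (q : ℝ) ^ (m * (d - 1)))⁻¹ with hc
  have hcpos : 0 < c := by positivity
  -- Trading `α(m, w - d + 1)` for `c α(m, w)` turns `[n, w] α(m, w)` into `N_R(w)`, which the
  -- symmetry of `N_R(w) J_R(u, s, w)` exchanges for the factor `N_R(u)` in the denominator.
  have hterm : ∀ w ∈ Finset.Icc d n, ∀ s,
      gaussBinom q n w * alpha q m (w - d + 1) * (interNum F m n u s w : ℝ) ≤
        c * (sphereCard F m n u * interNum F m n w s u) := by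
    intro w hw s
    rcases lt_or_ge m w with hmw | hmw
    · rw [interNum_eq_zero_of_lt hmw, Nat.cast_zero, mul_zero]
      positivity
    have h1 : (sphereCard F m n w * interNum F m n u s w : ℝ) =
        sphereCard F m n u * interNum F m n w s u := by
      exact_mod_cast sphereCard_mul_interNum F m n u s w
    rw [← h1, sphereCard_eq_card_mul_alpha, card_grassmannian, ← hqdef]
    have h2 : alpha q m (w - d + 1) ≤ c * alpha q m w := by
      rw [hc, inv_mul_eq_div, le_div_iff₀ (by positivity), mul_comm]
      exact Kq_mul_pow_mul_alpha_le hq hd (Finset.mem_Icc.1 hw).1 hmw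
    have h3 : 0 ≤ gaussBinom q n w := by
      rw [hqdef, ← card_grassmannian]
      positivity
    calc gaussBinom q n w * alpha q m (w - d + 1) * (interNum F m n u s w : ℝ)
        ≤ gaussBinom q n w * (c * alpha q m w) * (interNum F m n u s w : ℝ) := by gcongr
      _ = _ := by ring
  have hsum : ∑ w ∈ Finset.Icc d n, gaussBinom q n w * alpha q m (w - d + 1) *
      ∑ s ∈ Finset.range (t + 1), (interNum F m n u s w : ℝ) ≤
        c * (sphereCard F m n u * ∑ s ∈ Finset.range (t + 1), (sphereCard F m n s : ℝ)) := by
    calc _ = ∑ s ∈ Finset.range (t + 1), ∑ w ∈ Finset.Icc d n,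
          gaussBinom q n w * alpha q m (w - d + 1) * (interNum F m n u s w : ℝ) := by
          rw [Finset.sum_comm]
          simp only [Finset.mul_sum]
      _ ≤ ∑ s ∈ Finset.range (t + 1), ∑ w ∈ Finset.Icc d n,
          c * (sphereCard F m n u * interNum F m n w s u) :=
          Finset.sum_le_sum fun s _ => Finset.sum_le_sum fun w hw => hterm w hw s
      _ ≤ ∑ s ∈ Finset.range (t + 1), c * (sphereCard F m n u * (sphereCard F m n s : ℝ)) := by
          refine Finset.sum_le_sum fun s _ => ?_
          rw [← Finset.mul_sum, ← Finset.mul_sum]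
          have := sum_interNum_le F hm hn s (Finset.Icc d n)
          gcongr
          exact_mod_cast this
      _ = _ := by rw [← Finset.mul_sum, ← Finset.mul_sum]
  have hV := sum_sphereCard_lt F m ht
  rw [one_div_mul_eq_div, div_lt_iff₀ hN]
  refine hsum.trans_lt ?_
  have hfin : c * ((Kq q)⁻¹ * (q : ℝ) ^ (t * (n - t) + m * t)) =
      Kq q ^ (-2 : ℤ) * (q : ℝ) ^ ((t : ℤ) * (m + n - t) - (m : ℤ) * (d - 1)) := by
    rw [hc, zpow_sub₀ hq'.ne', show (-2 : ℤ) = -((2 : ℕ) : ℤ) by norm_num, zpow_neg, zpow_natCast,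
      show (t : ℤ) * (m + n - t) = ((t * (n - t) + m * t : ℕ) : ℤ) by
        push_cast [Nat.cast_sub ht]; ring,
      show (m : ℤ) * (d - 1) = ((m * (d - 1) : ℕ) : ℤ) by
        push_cast [Nat.cast_sub (show 1 ≤ d from hd)]; ring,
      zpow_natCast, zpow_natCast]
    field_simp
  rw [← hfin]
  calc c * (sphereCard F m n u * ∑ s ∈ Finset.range (t + 1), (sphereCard F m n s : ℝ))
      < c * (sphereCard F m n u * ((Kq q)⁻¹ * (q : ℝ) ^ (t * (n - t) + m * t))) := by gcongr
    _ = _ := by ring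

end Bounds

/-! ### Row space distributions of codes -/

section Codes

variable {F : Type*} [Field F] {m n : ℕ}

theorem HasMinDist.le_rankDist {𝒞 : Set (Matrix (Fin m) (Fin n) F)} {d : ℕ}
    (h : HasMinDist 𝒞 d) {X Y : Matrix (Fin m) (Fin n) F} (hX : X ∈ 𝒞) (hY : Y ∈ 𝒞)
    (hXY : X ≠ Y) : d ≤ rankDist X Y :=
  h.2 ⟨X, hX, Y, hY, hXY, rfl⟩

theorem HasMinDist.pos {𝒞 : Set (Matrix (Fin m) (Fin n) F)} {d : ℕ}
    (h : HasMinDist 𝒞 d) : 0 < d := by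
  obtain ⟨X, -, Y, -, hXY, rfl⟩ := h.1
  exact Nat.pos_of_ne_zero fun h0 => hXY (sub_eq_zero.1 (rank_eq_zero_iff.1 h0))

theorem HasMinDist.le_width {𝒞 : Set (Matrix (Fin m) (Fin n) F)} {d : ℕ}
    (h : HasMinDist 𝒞 d) : d ≤ n := by
  obtain ⟨X, -, Y, -, -, rfl⟩ := h.1
  exact (X - Y).rank_le_width

/-- Right multiplication by a matrix whose kernel has dimension less than the minimum distance is
injective on a code. -/
theorem HasMinDist.injOn_sub_mul {𝒞 : Set (Matrix (Fin m) (Fin n) F)} {d k : ℕ}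
    (h : HasMinDist 𝒞 d) (C : Matrix (Fin m) (Fin n) F) {Y : Matrix (Fin n) (Fin k) F}
    (hY : Module.finrank F (LinearMap.ker Y.vecMulLinear) < d) :
    Set.InjOn (fun D => (D - C) * Y) 𝒞 := by
  intro D hD D' hD' hDD'
  by_contra hne
  have h1 : (D - D') * Y = 0 := by
    rw [← sub_sub_sub_cancel_right D D' C, Matrix.sub_mul]
    exact sub_eq_zero.2 hDD'
  have h2 := Submodule.finrank_mono (mul_eq_zero_iff_rowSpace_le.1 h1)
  rw [finrank_rowSpace] at h2
  have h3 := h.le_rankDist hD hD' hne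
  rw [rankDist] at h3
  omega

theorem finrank_map_add_finrank_ker {V V' : Type*} [AddCommGroup V] [Module F V]
    [FiniteDimensional F V] [AddCommGroup V'] [Module F V'] (f : V →ₗ[F] V') {W : Submodule F V}
    (h : LinearMap.ker f ≤ W) :
    Module.finrank F (W.map f) + Module.finrank F (LinearMap.ker f) = Module.finrank F W := by
  rw [← LinearMap.finrank_range_add_finrank_ker (f.domRestrict W), LinearMap.range_domRestrict,
    LinearMap.ker_domRestrict, (Submodule.comapSubtypeEquivOfLe h).finrank_eq]

theorem rowDistribution_eq_zero {𝒞 : Set (Matrix (Fin m) (Fin n) F)} {d : ℕ}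
    (h : HasMinDist 𝒞 d) {C : Matrix (Fin m) (Fin n) F} (hC : C ∈ 𝒞)
    {W : Submodule F (Fin n → F)} (hW : 0 < Module.finrank F W) (hWd : Module.finrank F W < d) :
    rowDistribution 𝒞 C W = 0 := by
  rw [rowDistribution]
  refine (congrArg Set.ncard (Set.eq_empty_iff_forall_notMem.2 ?_)).trans
    (Set.ncard_empty _)
  rintro D ⟨hD, hDW⟩
  have h1 : rankDist D C = Module.finrank F W := by rw [rankDist, ← finrank_rowSpace, hDW]
  have h2 := h.le_rankDist hD hC fun h0 => by
    rw [h0, rankDist, sub_self, Matrix.rank_zero] at h1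
    omega
  omega

theorem rowDistribution_eq_one {𝒞 : Set (Matrix (Fin m) (Fin n) F)}
    {C : Matrix (Fin m) (Fin n) F} (hC : C ∈ 𝒞)
    {W : Submodule F (Fin n → F)} (hW : Module.finrank F W = 0) :
    rowDistribution 𝒞 C W = 1 := by
  rw [rowDistribution, Set.ncard_eq_one]
  refine ⟨C, Set.eq_singleton_iff_unique_mem.2 ⟨⟨hC, ?_⟩, ?_⟩⟩
  · rw [Submodule.finrank_eq_zero.1 hW, ← Submodule.finrank_eq_zero, finrank_rowSpace, sub_self,
      Matrix.rank_zero]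
  · rintro D ⟨-, hDW⟩
    rw [← sub_eq_zero, ← rank_eq_zero_iff, ← finrank_rowSpace, hDW, hW]

variable [Finite F]

/-- `A_W(C) ≤ α(m, w - d + 1)`: dividing out a subspace `K ≤ W` of dimension `d - 1` separates
the codewords and maps the differences `D - C` to matrices with row space `W / K`. -/
theorem rowDistribution_le_alpha {𝒞 : Set (Matrix (Fin m) (Fin n) F)} {d : ℕ}
    (h : HasMinDist 𝒞 d) (C : Matrix (Fin m) (Fin n) F) {W : Submodule F (Fin n → F)}
    (hW : d ≤ Module.finrank F W) :
    (rowDistribution 𝒞 C W : ℝ) ≤ alpha (Nat.card F) m (Module.finrank F W - d + 1) := by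
  have hd := h.pos
  obtain ⟨K, -, hKW, hK⟩ := exists_finrank_eq_between (bot_le (a := W)) (k := d - 1) (by simp)
    (by omega)
  obtain ⟨Y, hY⟩ := exists_ker_vecMulLinear_eq K hK
  have h1 := finrank_map_add_finrank_ker Y.vecMulLinear (W := W) (by rw [hY]; exact hKW)
  have h2 := ncard_rowSpace_eq m (W.map Y.vecMulLinear)
  rw [hY, hK] at h1
  rw [show Module.finrank F W - d + 1 = Module.finrank F (W.map Y.vecMulLinear) by omega, ← h2,
    Nat.cast_le]
  refine Set.ncard_le_ncard_of_injOn (fun D => (D - C) * Y) ?_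
    ((h.injOn_sub_mul C (by rw [hY, hK]; omega)).mono fun D hD => hD.1) (Set.toFinite _)
  rintro D ⟨-, hD⟩
  rw [Set.mem_ofPred_eq, rowSpace_mul, hD]

/-- The exponent `m (n - d + 1)` attains the minimum in the Singleton bound when `n ≤ m`. -/
theorem IsMRD.ncard_eq {𝒞 : Set (Matrix (Fin m) (Fin n) F)} {d : ℕ} (hnm : n ≤ m)
    (h : IsMRD 𝒞 d) : 𝒞.ncard = Nat.card F ^ (m * (n - d + 1)) := by
  rw [h.2]
  refine min_eq_left (Nat.pow_le_pow_right (by have := two_le_natCard F; omega) ?_)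
  obtain ⟨a, rfl⟩ := Nat.exists_eq_add_of_le h.1.le_width
  obtain ⟨b, rfl⟩ := Nat.exists_eq_add_of_le hnm
  have hd := h.1.pos
  rw [show d + a - d + 1 = a + 1 by omega, show d + a + b - d + 1 = a + b + 1 by omega]
  nlinarith

/-- In a maximum rank distance code, the number of codewords `D` such that the row space of
`D - C` is contained in `W`, `dim W ≥ d`, is `q ^ (m (dim W - d + 1))`: dividing out a subspace of
`W` of dimension `d - 1` maps the code bijectively onto all `m × (n - d + 1)` matrices. -/
theorem IsMRD.ncard_rowSpace_sub_le {𝒞 : Set (Matrix (Fin m) (Fin n) F)} {d : ℕ} (hnm : n ≤ m)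
    (h : IsMRD 𝒞 d) (C : Matrix (Fin m) (Fin n) F) {W : Submodule F (Fin n → F)}
    (hW : d ≤ Module.finrank F W) :
    {D | D ∈ 𝒞 ∧ rowSpace (D - C) ≤ W}.ncard =
      Nat.card F ^ (m * (Module.finrank F W - d + 1)) := by
  have hd := h.1.pos
  have hdn := h.1.le_width
  obtain ⟨K, -, hKW, hK⟩ := exists_finrank_eq_between (bot_le (a := W)) (k := d - 1) (by simp)
    (by omega)
  obtain ⟨Y, hY⟩ := exists_ker_vecMulLinear_eq K hK
  have h1 := finrank_map_add_finrank_ker Y.vecMulLinear (W := W) (by rw [hY]; exact hKW)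
  rw [hY, hK] at h1
  have hinj := h.1.injOn_sub_mul C (Y := Y) (by rw [hY, hK]; omega)
  have himg : (fun D => (D - C) * Y) '' 𝒞 = Set.univ := by
    refine Set.eq_of_subset_of_ncard_le (Set.subset_univ _) ?_ (Set.toFinite _)
    have h3 := ncard_rowSpace_le m (⊤ : Submodule F (Fin (n - (d - 1)) → F))
    simp only [le_top, Set.ofPred_true, finrank_top, Module.finrank_fin_fun] at h3
    rw [hinj.ncard_image, h.ncard_eq hnm, h3,
      show n - (d - 1) = n - d + 1 by omega]
  rw [show Module.finrank F W - d + 1 = Module.finrank F (W.map Y.vecMulLinear) by omega,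
    ← ncard_rowSpace_le m (W.map Y.vecMulLinear)]
  have hiff : ∀ D, rowSpace (D - C) ≤ W ↔
      rowSpace ((D - C) * Y) ≤ W.map Y.vecMulLinear := by
    intro D
    rw [rowSpace_mul, Submodule.map_le_iff_le_comap, Submodule.comap_map_eq, hY,
      sup_eq_left.2 hKW]
  refine Set.ncard_congr (fun D _ => (D - C) * Y) (fun D hD => (hiff D).1 hD.2)
    (fun D D' hD hD' hDD' => hinj hD.1 hD'.1 hDD') ?_
  intro Z hZ
  obtain ⟨D, hD, rfl⟩ : Z ∈ (fun D => (D - C) * Y) '' 𝒞 := by rw [himg]; trivial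
  exact ⟨D, ⟨hD, (hiff D).2 hZ⟩, rfl⟩

/-- In a maximum rank distance code, `A_W(C)` depends only on `m`, `n`, `d` and `dim W`. By
induction on `dim W`: a linear automorphism carrying `W` to `W'` matches their proper subspaces,
so that the sums of `A_V(C)` over all `V ≤ W` and over all `V ≤ W'`, which agree by
`IsMRD.ncard_rowSpace_sub_le`, agree in all terms but the last. -/
theorem IsMRD.rowDistribution_eq {𝒞 𝒞' : Set (Matrix (Fin m) (Fin n) F)} {d : ℕ} (hnm : n ≤ m)
    (h : IsMRD 𝒞 d) (h' : IsMRD 𝒞' d) {C C' : Matrix (Fin m) (Fin n) F} (hC : C ∈ 𝒞)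
    (hC' : C' ∈ 𝒞') {W W' : Submodule F (Fin n → F)}
    (hWW' : Module.finrank F W = Module.finrank F W') :
    rowDistribution 𝒞 C W = rowDistribution 𝒞' C' W' := by
  classical
  induction hw : Module.finrank F W using Nat.strong_induction_on generalizing W W' with
  | _ w ih =>
  rcases Nat.eq_zero_or_pos w with h0 | hpos
  · rw [rowDistribution_eq_one hC (by omega), rowDistribution_eq_one hC' (by omega)]
  rcases lt_or_ge w d with hwd | hwd
  · rw [rowDistribution_eq_zero h.1 hC (by omega) (by omega),
      rowDistribution_eq_zero h'.1 hC' (by omega) (by omega)]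
  have hfin := Fintype.ofFinite (Submodule F (Fin n → F))
  obtain ⟨g, hg⟩ := Submodule.exists_linearEquiv_restrict_eq (LinearEquiv.ofFinrankEq W W' hWW')
  have hgW : W.map g.toLinearMap = W' := by
    refine Submodule.eq_of_le_of_finrank_eq ?_ ?_
    · rintro _ ⟨x, hx, rfl⟩
      have h1 := hg ⟨x, hx⟩
      change g x ∈ W'
      rw [← h1]
      exact Subtype.property _
    · rw [← hWW']
      exact LinearEquiv.finrank_map_eq g W
  have hsplit : ∀ (𝒟 : Set (Matrix (Fin m) (Fin n) F)) (E : Matrix (Fin m) (Fin n) F)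
      (X : Submodule F (Fin n → F)), {D | D ∈ 𝒟 ∧ rowSpace (D - E) ≤ X}.ncard =
        rowDistribution 𝒟 E X +
          ∑ V ∈ Finset.univ.filter (fun V => V < X), rowDistribution 𝒟 E V := by
    intro 𝒟 E X
    rw [ncard_eq_sum_ncard_fiber _ (fun D => rowSpace (D - E))
        (insert X (Finset.univ.filter (fun V => V < X))) fun D hD => by
          simpa [le_iff_eq_or_lt] using hD.2,
      Finset.sum_insert (by simp)]
    congr 1
    · rw [rowDistribution]
      congr 1
      ext D
      simp only [Set.mem_ofPred_eq]
      exact ⟨fun hD => ⟨hD.1.1, hD.2⟩, fun hD => ⟨⟨hD.1, hD.2.le⟩, hD.2⟩⟩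
    · refine Finset.sum_congr rfl fun V hV => ?_
      have hV : V < X := by simpa using hV
      rw [rowDistribution]
      congr 1
      ext D
      simp only [Set.mem_ofPred_eq]
      exact ⟨fun hD => ⟨hD.1.1, hD.2⟩, fun hD => ⟨⟨hD.1, hD.2.le.trans hV.le⟩, hD.2⟩⟩
  have hsum : ∑ V ∈ Finset.univ.filter (fun V => V < W), rowDistribution 𝒞 C V =
      ∑ V ∈ Finset.univ.filter (fun V => V < W'), rowDistribution 𝒞' C' V := by
    refine Finset.sum_equiv (Submodule.orderIsoMapComap g).toEquiv ?_ ?_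
    · intro V
      simp only [Finset.mem_filter, Finset.mem_univ, true_and]
      rw [← hgW]
      exact ((Submodule.orderIsoMapComap g).lt_iff_lt (x := V) (y := W)).symm
    · intro V hV
      have hV : V < W := by simpa using hV
      have hlt := Submodule.finrank_lt_finrank_of_lt hV
      exact ih _ (by omega) (LinearEquiv.finrank_map_eq g V).symm rfl
  have e1 := hsplit 𝒞 C W
  have e2 := hsplit 𝒞' C' W'
  rw [h.ncard_rowSpace_sub_le hnm C (by omega)] at e1
  rw [h'.ncard_rowSpace_sub_le hnm C' (by omega), ← hWW'] at e2
  omega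

/-- The codewords at distance `w` from `C` are equidistributed over the row spaces of dimension
`w`, and `M(d, w)` can be computed with any maximum rank distance code. -/
theorem IsMRD.mrdNum_eq {𝒞 : Set (Matrix (Fin m) (Fin n) F)} {d : ℕ} (hnm : n ≤ m)
    (h : IsMRD 𝒞 d) {C : Matrix (Fin m) (Fin n) F} (hC : C ∈ 𝒞) {W : Submodule F (Fin n → F)} :
    mrdNum F m n d (Module.finrank F W) =
      (grassmannian F n (Module.finrank F W)).card * rowDistribution 𝒞 C W := by
  classical
  have hex : ∃ P : Set (Matrix (Fin m) (Fin n) F) × Matrix (Fin m) (Fin n) F,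
      IsMRD P.1 d ∧ P.2 ∈ P.1 := ⟨(𝒞, C), h, hC⟩
  rw [mrdNum, dif_pos hex]
  have hs := hex.choose_spec
  generalize hex.choose = P at hs
  have h1 := ncard_eq_sum_ncard_fiber (fun D => D ∈ P.1 ∧ rankDist D P.2 = Module.finrank F W)
    (fun D => rowSpace (D - P.2)) (grassmannian F n (Module.finrank F W))
    fun D hD => by rw [mem_grassmannian, finrank_rowSpace]; exact hD.2
  refine h1.trans (Finset.sum_const_nat fun V hV => ?_)
  rw [h.rowDistribution_eq hnm hs.1 hC hs.2 (mem_grassmannian.1 hV).symm, rowDistribution]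
  congr 1
  ext D
  simp only [Set.mem_ofPred_eq]
  refine ⟨fun hD => ⟨hD.1.1, hD.2⟩, fun hD => ⟨⟨hD.1, ?_⟩, hD.2⟩⟩
  rw [rankDist, ← finrank_rowSpace, hD.2, mem_grassmannian.1 hV]

end Codes

/-! ### The decoder error probability -/

section Decoding

variable {F : Type*} [Field F] {m n : ℕ}

theorem exists_of_errorRowSpaceProb_ne_zero
    {Q : Matrix (Fin m) (Fin n) F → PMF (Matrix (Fin m) (Fin n) F)}
    {C : Matrix (Fin m) (Fin n) F} {U : Submodule F (Fin n → F)}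
    (h : errorRowSpaceProb Q C U ≠ 0) : ∃ Y, rowSpace (Y - C) = U ∧ Q C Y ≠ 0 := by
  rw [errorRowSpaceProb, Ne, PMF.toOuterMeasure_apply_eq_zero_iff,
    Set.not_disjoint_iff] at h
  obtain ⟨Y, hY, hYU⟩ := h
  exact ⟨Y, hYU, (PMF.mem_support_iff _ _).1 hY⟩

theorem decoderErrorProb_eq_zero {𝒞 : Set (Matrix (Fin m) (Fin n) F)} {d t : ℕ}
    (h : HasMinDist 𝒞 d) {C : Matrix (Fin m) (Fin n) F} (hC : C ∈ 𝒞)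
    (Q : Matrix (Fin m) (Fin n) F → PMF (Matrix (Fin m) (Fin n) F))
    {U : Submodule F (Fin n → F)} (hU : Module.finrank F U < d - t)
    {δ : Matrix (Fin m) (Fin n) F → Option (Matrix (Fin m) (Fin n) F)}
    (hδ : IsBoundedDistanceDecoder 𝒞 t δ) : decoderErrorProb Q δ C U = 0 := by
  have hempty : {Y | rowSpace (Y - C) = U ∧ ∃ D, δ Y = some D ∧ D ≠ C} = ∅ := by
    refine Set.eq_empty_iff_forall_notMem.2 ?_
    rintro Y ⟨hY, D, hδY, hDC⟩
    obtain ⟨hD, hYD⟩ := hδ.1 Y D hδY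
    have h1 := h.le_rankDist hD hC hDC
    have h2 := rankDist_triangle D Y C
    have h3 : rankDist Y C = Module.finrank F U := by rw [rankDist, ← finrank_rowSpace, hY]
    rw [rankDist_comm D Y] at h2
    omega
  rw [decoderErrorProb, hempty]
  simp

variable [Finite F]

theorem ncard_rowSpace_sub_eq (C : Matrix (Fin m) (Fin n) F) (U : Submodule F (Fin n → F)) :
    ({Y | rowSpace (Y - C) = U}.ncard : ℝ) = alpha (Nat.card F) m (Module.finrank F U) := by
  rw [← ncard_rowSpace_eq]
  congr 1
  exact Set.ncard_congr (fun Y _ => Y - C) (fun Y hY => hY) (fun _ _ _ _ h => sub_left_injective h)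
    fun X hX => ⟨X + C, by simpa using hX, by simp⟩

/-- On an equal row space channel the error is uniformly distributed over the matrices with its
row space. -/
theorem decoderErrorProb_eq_ncard_div
    {Q : Matrix (Fin m) (Fin n) F → PMF (Matrix (Fin m) (Fin n) F)} (hQ : IsEqualRowSpace Q)
    (δ : Matrix (Fin m) (Fin n) F → Option (Matrix (Fin m) (Fin n) F))
    (C : Matrix (Fin m) (Fin n) F) {U : Submodule F (Fin n → F)}
    (hU : errorRowSpaceProb Q C U ≠ 0) :
    decoderErrorProb Q δ C U =
      {Y | rowSpace (Y - C) = U ∧ ∃ D, δ Y = some D ∧ D ≠ C}.ncard /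
        alpha (Nat.card F) m (Module.finrank F U) := by
  classical
  have := Fintype.ofFinite F
  obtain ⟨Y₀, hY₀, hp⟩ := exists_of_errorRowSpaceProb_ne_zero hU
  have hconst : ∀ Y, rowSpace (Y - C) = U → Q C Y = Q C Y₀ := by
    intro Y hY
    have := hQ C (Y - C) (Y₀ - C) (by rw [hY, hY₀])
    rwa [add_sub_cancel, add_sub_cancel] at this
  have key : ∀ A : Set (Matrix (Fin m) (Fin n) F), (∀ Y ∈ A, rowSpace (Y - C) = U) →
      (Q C).toOuterMeasure A = A.ncard * Q C Y₀ := by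
    intro A hA
    rw [← Set.coe_toFinset A, Set.ncard_coe_finset, PMF.toOuterMeasure_apply_finset,
      Finset.sum_congr rfl fun Y hY => hconst Y (hA Y (Set.mem_toFinset.1 hY)), Finset.sum_const,
      nsmul_eq_mul]
  rw [decoderErrorProb, errorRowSpaceProb, key _ fun Y hY => hY.1,
    key {Y | rowSpace (Y - C) = U} fun Y hY => hY,
    ENNReal.mul_div_mul_right _ _ hp (PMF.apply_ne_top _ _), ENNReal.toReal_div,
    ENNReal.toReal_natCast, ENNReal.toReal_natCast, ncard_rowSpace_sub_eq]

theorem ncard_rowSpace_sub_ball (C D : Matrix (Fin m) (Fin n) F) (U : Submodule F (Fin n → F))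
    (t : ℕ) :
    {Y | rowSpace (Y - C) = U ∧ rankDist Y D ≤ t}.ncard =
      ∑ s ∈ Finset.range (t + 1), rowNum m U s (rowSpace (D - C)) := by
  rw [ncard_eq_sum_ncard_fiber _ (fun Y => rankDist Y D) (Finset.range (t + 1)) fun Y hY =>
    Finset.mem_range.2 (Nat.lt_succ_of_le hY.2)]
  refine Finset.sum_congr rfl fun s hs => ?_
  rw [← ncard_rowSpace_sphere]
  have hs := Finset.mem_range.1 hs
  refine Set.ncard_congr (fun Y _ => Y - C) ?_ (fun _ _ _ _ h => sub_left_injective h) ?_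
  · rintro Y ⟨⟨h1, -⟩, h2⟩
    exact ⟨h1, by rw [rankDist, sub_sub_sub_cancel_right]; exact h2⟩
  · rintro X ⟨h1, h2⟩
    have h3 : rankDist (X + C) D = s := by
      rw [← h2, rankDist, rankDist]
      congr 1
      abel
    exact ⟨X + C, ⟨⟨by simpa using h1, by omega⟩, h3⟩, by simp⟩

/-- Balls of radius `t` around distinct codewords are disjoint, so the received matrices decoded
to a codeword other than `C` correspond to the pairs of such a codeword `D` and a received matrix
in the ball around `D`; these are grouped by the row space `W` of `D - C`. -/
theorem ncard_decoder_error {𝒞 : Set (Matrix (Fin m) (Fin n) F)} {d t : ℕ} (h : HasMinDist 𝒞 d)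
    (ht : 2 * t < d) {C : Matrix (Fin m) (Fin n) F} (hC : C ∈ 𝒞) (U : Submodule F (Fin n → F))
    {δ : Matrix (Fin m) (Fin n) F → Option (Matrix (Fin m) (Fin n) F)}
    (hδ : IsBoundedDistanceDecoder 𝒞 t δ) :
    {Y | rowSpace (Y - C) = U ∧ ∃ D, δ Y = some D ∧ D ≠ C}.ncard =
      ∑ w ∈ Finset.Icc d n, ∑ W ∈ grassmannian F n w,
        rowDistribution 𝒞 C W * ∑ s ∈ Finset.range (t + 1), rowNum m U s W := by
  classical
  have hd := h.pos
  have hpair : {Y | rowSpace (Y - C) = U ∧ ∃ D, δ Y = some D ∧ D ≠ C}.ncard =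
      {x : Matrix (Fin m) (Fin n) F × Matrix (Fin m) (Fin n) F |
        (x.1 ∈ 𝒞 ∧ x.1 ≠ C) ∧ rowSpace (x.2 - C) = U ∧ rankDist x.2 x.1 ≤ t}.ncard := by
    symm
    have huniq : ∀ Y D D', D ∈ 𝒞 → D' ∈ 𝒞 → rankDist Y D ≤ t → rankDist Y D' ≤ t → D = D' := by
      intro Y D D' hD hD' h1 h2
      by_contra hne
      have h3 := h.le_rankDist hD hD' hne
      have h4 := rankDist_triangle D Y D'
      rw [rankDist_comm D Y] at h4
      omega
    refine Set.ncard_congr (fun x _ => x.2) ?_ ?_ ?_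
    · rintro ⟨D, Y⟩ ⟨⟨hD, hDC⟩, hY, hYD⟩
      refine ⟨hY, D, ?_, hDC⟩
      cases hδY : δ Y with
      | none => exact absurd (hδ.2 Y hδY D hD) (not_lt.2 hYD)
      | some D' =>
        have := hδ.1 Y D' hδY
        rw [huniq Y D' D this.1 hD this.2 hYD]
    · rintro ⟨D, Y⟩ ⟨D', Y'⟩ ⟨⟨hD, -⟩, -, hYD⟩ ⟨⟨hD', -⟩, -, hYD'⟩ hYY'
      obtain rfl : Y = Y' := hYY'
      rw [huniq Y D D' hD hD' hYD hYD']
    · rintro Y ⟨hY, D, hδY, hDC⟩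
      have := hδ.1 Y D hδY
      exact ⟨(D, Y), ⟨⟨this.1, hDC⟩, hY, this.2⟩, rfl⟩
  have hdisj : Set.PairwiseDisjoint (↑(Finset.Icc d n)) (grassmannian F n) := by
    intro w _ w' _ hww'
    refine Finset.disjoint_left.2 fun W hW hW' => hww' ?_
    rw [← mem_grassmannian.1 hW, mem_grassmannian.1 hW']
  rw [hpair, ← Finset.sum_biUnion hdisj,
    ncard_eq_sum_ncard_fiber _ (fun x => rowSpace (x.1 - C))
      ((Finset.Icc d n).biUnion (grassmannian F n)) fun x hx => by
        refine Finset.mem_biUnion.2 ⟨rankDist x.1 C, Finset.mem_Icc.2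
          ⟨h.le_rankDist hx.1.1 hC hx.1.2, (x.1 - C).rank_le_width⟩, ?_⟩
        rw [mem_grassmannian, finrank_rowSpace, rankDist]]
  refine Finset.sum_congr rfl fun W hW => ?_
  obtain ⟨w, hw, hWw⟩ := Finset.mem_biUnion.1 hW
  have hw := (Finset.mem_Icc.1 hw).1
  have hWw := mem_grassmannian.1 hWw
  have hp := ncard_pairs (fun D => D ∈ 𝒞 ∧ rowSpace (D - C) = W)
    (fun D Y => rowSpace (Y - C) = U ∧ rankDist Y D ≤ t)
    (∑ s ∈ Finset.range (t + 1), rowNum m U s W)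
    fun D hD => by rw [ncard_rowSpace_sub_ball, hD.2]
  rw [rowDistribution, ← hp]
  congr 1
  ext ⟨D, Y⟩
  simp only [Set.mem_ofPred_eq]
  constructor
  · rintro ⟨⟨⟨hD, -⟩, hY⟩, hDW⟩
    exact ⟨⟨hD, hDW⟩, hY⟩
  · rintro ⟨⟨hD, hDW⟩, hY⟩
    refine ⟨⟨⟨hD, ?_⟩, hY⟩, hDW⟩
    rintro rfl
    rw [← hDW, finrank_rowSpace, sub_self, Matrix.rank_zero] at hWw
    omega

/-- Each of the `α(m, dim U)` equiprobable errors has probability `1 / α(m, dim U)`. -/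
theorem decoderErrorProb_eq {𝒞 : Set (Matrix (Fin m) (Fin n) F)} {d t : ℕ} (h : HasMinDist 𝒞 d)
    (ht : 2 * t < d) {C : Matrix (Fin m) (Fin n) F} (hC : C ∈ 𝒞)
    {Q : Matrix (Fin m) (Fin n) F → PMF (Matrix (Fin m) (Fin n) F)} (hQ : IsEqualRowSpace Q)
    {U : Submodule F (Fin n → F)} (hU : errorRowSpaceProb Q C U ≠ 0)
    {δ : Matrix (Fin m) (Fin n) F → Option (Matrix (Fin m) (Fin n) F)}
    (hδ : IsBoundedDistanceDecoder 𝒞 t δ) :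
    decoderErrorProb Q δ C U =
      1 / alpha (Nat.card F) m (Module.finrank F U) *
        ∑ w ∈ Finset.Icc d n, ∑ W ∈ grassmannian F n w,
          (rowDistribution 𝒞 C W : ℝ) *
            ∑ s ∈ Finset.range (t + 1), (rowNum m U s W : ℝ) := by
  rw [decoderErrorProb_eq_ncard_div hQ δ C hU, ncard_decoder_error h ht hC U hδ,
    one_div_mul_eq_div]
  push_cast
  rfl

/-- `sum_rowNum` summed over `s` and, with weights depending only on the dimension of `W`, over
`w`. -/
theorem sum_mul_sum_rowNum (U : Submodule F (Fin n → F)) (hU : Module.finrank F U ≤ m)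
    (a : ℕ → ℝ) (I : Finset ℕ) (t : ℕ) :
    1 / alpha (Nat.card F) m (Module.finrank F U) *
        ∑ w ∈ I, ∑ W ∈ grassmannian F n w,
          a w * ∑ s ∈ Finset.range (t + 1), (rowNum m U s W : ℝ) =
      1 / (sphereCard F m n (Module.finrank F U) : ℝ) *
        ∑ w ∈ I, gaussBinom (Nat.card F) n w * a w *
          ∑ s ∈ Finset.range (t + 1), (interNum F m n (Module.finrank F U) s w : ℝ) := by
  rw [Finset.mul_sum, Finset.mul_sum]
  refine Finset.sum_congr rfl fun w _ => ?_
  rw [← Finset.mul_sum, Finset.sum_comm, mul_left_comm, Finset.mul_sum,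
    Finset.sum_congr rfl fun s _ => sum_rowNum U hU s w, ← Finset.mul_sum, ← Finset.mul_sum]
  ring

end Decoding

end RankMetric

end

theorem proposition1 {F : Type*} [Field F] [Finite F] {m n : ℕ}
    (𝒞 : Set (Matrix (Fin m) (Fin n) F)) (d : ℕ) (h𝒞 : RankMetric.HasMinDist 𝒞 d)
    (C : Matrix (Fin m) (Fin n) F) (hC : C ∈ 𝒞)
    (Q : Matrix (Fin m) (Fin n) F → PMF (Matrix (Fin m) (Fin n) F))
    (hQ : RankMetric.IsEqualRowSpace Q)
    (u : ℕ) (U : Submodule F (Fin n → F)) (hU : U ∈ RankMetric.grassmannian F n u)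
    (hQU : RankMetric.errorRowSpaceProb Q C U ≠ 0)
    (t : ℕ) (ht : t = (d - 1) / 2)
    (δ : Matrix (Fin m) (Fin n) F → Option (Matrix (Fin m) (Fin n) F))
    (hδ : RankMetric.IsBoundedDistanceDecoder 𝒞 t δ)
    (q : ℕ) (hq : q = Nat.card F) :
    (u < d - t → RankMetric.decoderErrorProb Q δ C U = 0) ∧
    (d - t ≤ u →
      RankMetric.decoderErrorProb Q δ C U =
        1 / RankMetric.alpha q m u *
          ∑ w ∈ Finset.Icc d n, ∑ W ∈ RankMetric.grassmannian F n w,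
            (RankMetric.rowDistribution 𝒞 C W : ℝ) *
              ∑ s ∈ Finset.range (t + 1), (RankMetric.rowNum m U s W : ℝ) ∧
      1 / RankMetric.alpha q m u *
          ∑ w ∈ Finset.Icc d n, ∑ W ∈ RankMetric.grassmannian F n w,
            (RankMetric.rowDistribution 𝒞 C W : ℝ) *
              ∑ s ∈ Finset.range (t + 1), (RankMetric.rowNum m U s W : ℝ) ≤
        1 / (RankMetric.sphereCard F m n u : ℝ) *
          ∑ w ∈ Finset.Icc d n, RankMetric.gaussBinom q n w * RankMetric.alpha q m (w - d + 1) *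
            ∑ s ∈ Finset.range (t + 1), (RankMetric.interNum F m n u s w : ℝ) ∧
      (d = 2 * t + 1 →
        1 / (RankMetric.sphereCard F m n u : ℝ) *
          ∑ w ∈ Finset.Icc d n, RankMetric.gaussBinom q n w * RankMetric.alpha q m (w - d + 1) *
            ∑ s ∈ Finset.range (t + 1), (RankMetric.interNum F m n u s w : ℝ) <
        RankMetric.Kq q ^ (-2 : ℤ) * (q : ℝ) ^ (-(t : ℤ) * ((m : ℤ) - n + t))) ∧
      (d = 2 * t + 2 →
        1 / (RankMetric.sphereCard F m n u : ℝ) *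
          ∑ w ∈ Finset.Icc d n, RankMetric.gaussBinom q n w * RankMetric.alpha q m (w - d + 1) *
            ∑ s ∈ Finset.range (t + 1), (RankMetric.interNum F m n u s w : ℝ) <
        RankMetric.Kq q ^ (-2 : ℤ) * (q : ℝ) ^ (-(t : ℤ) * ((m : ℤ) - n + t) - m))) ∧
    (n ≤ m → RankMetric.IsMRD 𝒞 d → RankMetric.IsLinearCode 𝒞 →
      RankMetric.decoderErrorProb Q δ C U =
        1 / (RankMetric.sphereCard F m n u : ℝ) *
          ∑ w ∈ Finset.Icc d n, (RankMetric.mrdNum F m n d w : ℝ) *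
            ∑ s ∈ Finset.range (t + 1), (RankMetric.interNum F m n u s w : ℝ)) := by
  have hd := h𝒞.pos
  have hdn := h𝒞.le_width
  have hUu := RankMetric.mem_grassmannian.1 hU
  have hun : u ≤ n := by rw [← hUu]; simpa using U.finrank_le
  have hum : u ≤ m := by
    obtain ⟨Y, hY, -⟩ := RankMetric.exists_of_errorRowSpaceProb_ne_zero hQU
    rw [← hUu, ← hY, RankMetric.finrank_rowSpace]
    exact (Y - C).rank_le_height
  have hprob := RankMetric.decoderErrorProb_eq h𝒞 (t := t) (by omega) hC hQ hQU hδ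
  have havg := fun a => RankMetric.sum_mul_sum_rowNum (m := m) U (by omega) a (Finset.Icc d n) t
  have hα := RankMetric.alpha_pos (RankMetric.two_le_natCard F) hum
  have hbound := RankMetric.error_bound_lt F hd (by omega : t ≤ n) hum hun
  rw [hUu] at hprob havg
  subst hq
  refine ⟨fun hu => RankMetric.decoderErrorProb_eq_zero h𝒞 hC Q (by omega) hδ,
    fun hu => ⟨hprob, ?_, fun hdt => ?_, fun hdt => ?_⟩, fun hnm hMRD _ => ?_⟩
  · rw [← havg]
    refine mul_le_mul_of_nonneg_left ?_ (by positivity)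
    refine Finset.sum_le_sum fun w hw => Finset.sum_le_sum fun W hW => ?_
    refine mul_le_mul_of_nonneg_right ?_ (by positivity)
    have hWw := RankMetric.mem_grassmannian.1 hW
    rw [← hWw]
    exact RankMetric.rowDistribution_le_alpha h𝒞 C (by rw [hWw]; exact (Finset.mem_Icc.1 hw).1)
  · refine hbound.trans_eq ?_
    congr 2
    rw [hdt]
    push_cast
    ring
  · refine hbound.trans_eq ?_
    congr 2
    rw [hdt]
    push_cast
    ring
  · rw [hprob]
    -- `M(d, w) / [n, w]` is the common value of `A_W(C)` on the `w`-dimensional subspaces.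
    have hA : ∀ w ∈ Finset.Icc d n, ∀ W ∈ RankMetric.grassmannian F n w,
        (RankMetric.rowDistribution 𝒞 C W : ℝ) =
          RankMetric.mrdNum F m n d w / RankMetric.gaussBinom (Nat.card F) n w := by
      intro w _ W hW
      have hcard : ((RankMetric.grassmannian F n w).card : ℝ) ≠ 0 :=
        Nat.cast_ne_zero.2 (Finset.card_ne_zero_of_mem hW)
      have h1 := hMRD.mrdNum_eq hnm hC (W := W)
      rw [RankMetric.mem_grassmannian.1 hW] at h1
      rw [h1, ← RankMetric.card_grassmannian, Nat.cast_mul, mul_div_cancel_left₀ _ hcard]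
    rw [Finset.sum_congr rfl fun w hw => Finset.sum_congr rfl fun W hW => by rw [hA w hw W hW],
      havg]
    refine congrArg _ (Finset.sum_congr rfl fun w hw => ?_)
    have hg : RankMetric.gaussBinom (Nat.card F) n w ≠ 0 :=
      (div_pos (RankMetric.alpha_pos (RankMetric.two_le_natCard F) (Finset.mem_Icc.1 hw).2)
        (RankMetric.alpha_pos (RankMetric.two_le_natCard F) le_rfl)).ne'
    rw [mul_div_cancel₀ _ hg]
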